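/- Let $\overline{\mathbb{Q}}\cap\mathbb{R}$ be the field of real algebraic numbers and, for a subfield $K\subset\mathbb{R}$, call a subset of $\mathbb{R}^n$ $K$-semialgebraic if it is obtained from sets $\{x\in\mathbb{R}^n : P(x)\ge 0\}$, $P\in K[x_1,\dots,x_n]$, by finitely many unions, intersections and complements. (1) Every subset of $\mathbb{R}^n$ defined by finitely many polynomial equations $P(x)=0$ and inequalities $P(x)\ge 0$ or $P(x)>0$ with coefficients in $\overline{\mathbb{Q}}\cap\mathbb{R}$ is $\mathbb{Q}$-semialgebraic. More generally, every $(\overline{\mathbb{Q}}\cap\mathbb{R})$-semialgebraic subset of $\mathbb{R}^n$ is $\mathbb{Q}$-semialgebraic. (2) Consequently, algebraic coefficients and algebraic functions give no new periods. A period is a complex number whose real and imaginary parts can both be written as absolutely convergent integrals $\int_S f(x_1,\dots,x_n)\,dx_1\cdots dx_n$ with $n\ge 1$, where $S\subset\mathbb{R}^n$ is $\mathbb{Q}$-semialgebraic and $f=P/Q$ with $P,Q\in\mathbb{Q}[x_1,\dots,x_n]$, $Q\neq 0$. The set of periods does not change if one replaces $\mathbb{Q}$ by $\overline{\mathbb{Q}}\cap\mathbb{R}$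 throughout this definition; nor does it change if, moreover, one allows $f$ to be an arbitrary real algebraic function on $S$ over $\overline{\mathbb{Q}}\cap\mathbb{R}$. Here $f$ is called an algebraic function on $S$ over $K$ if there are nonzero polynomials $D\in K[x_1,\dots,x_n]$ and $F\in K[x_1,\dots,x_n,t]$ such that, on $\{x\in S : D(x)\neq 0\}$, $f$ is continuous and $F(x,f(x))=0$. -/

import Mathlib

namespace KZPeriod

/-- The field of real algebraic numbers. -/
noncomputable abbrev RealAlg : IntermediateField ℚ ℝ := algebraicClosure ℚ ℝ

section

variable (K : Type) [Field K] [Algebra K ℝ]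

/-- `K`-semialgebraic subsets of `ℝⁿ`: the smallest family of subsets that contains the sets
`{x | P(x) ≥ 0}`, `P` a polynomial with coefficients in `K`, and is stable under (finite) unions,
intersections and complements. -/
inductive IsSemialgebraic {n : ℕ} : Set (Fin n → ℝ) → Prop
  | nonneg (P : MvPolynomial (Fin n) K) :
      IsSemialgebraic {x : Fin n → ℝ | 0 ≤ MvPolynomial.aeval x P}
  | union (S T : Set (Fin n → ℝ)) :
      IsSemialgebraic S → IsSemialgebraic T → IsSemialgebraic (S ∪ T)
  | inter (S T : Set (Fin n → ℝ)) :
      IsSemialgebraic S → IsSemialgebraic T → IsSemialgebraic (S ∩ T)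
  | compl (S : Set (Fin n → ℝ)) :
      IsSemialgebraic S → IsSemialgebraic Sᶜ

/-- `S ⊆ ℝⁿ` is the set of solutions of a finite system of polynomial equations `P(x) = 0`
(`P ∈ E`) and inequalities `P(x) ≥ 0` (`P ∈ G`), `P(x) > 0` (`P ∈ H`), with coefficients
in `K`. -/
def IsDefinedByPolynomials {n : ℕ} (S : Set (Fin n → ℝ)) : Prop :=
  ∃ E G H : Finset (MvPolynomial (Fin n) K),
    S = {x : Fin n → ℝ | (∀ P ∈ E, MvPolynomial.aeval x P = 0) ∧
      (∀ P ∈ G, 0 ≤ MvPolynomial.aeval x P) ∧ (∀ P ∈ H, 0 < MvPolynomial.aeval x P)}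

/-- `f` is given by a rational function `P / Q` with coefficients in `K`, `Q ≠ 0`
(the zero set of `Q`, where the value is the conventional `0`, is Lebesgue negligible). -/
def IsRationalFunction {n : ℕ} (f : (Fin n → ℝ) → ℝ) : Prop :=
  ∃ P Q : MvPolynomial (Fin n) K, Q ≠ 0 ∧
    f = fun x => MvPolynomial.aeval x P / MvPolynomial.aeval x Q

/-- `f` is a (real, single-valued) algebraic function over `K` on `S`: off the zero set of some
nonzero polynomial `D` (which allows for poles and ramification), `f` is continuous on `S` and
`f(x)` is a root of `F(x, t)`, where `F` is a nonzero polynomial in `t` whose coefficients are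
polynomials in `x` over `K`. -/
def IsAlgebraicFunctionOn {n : ℕ} (S : Set (Fin n → ℝ)) (f : (Fin n → ℝ) → ℝ) : Prop :=
  ∃ (D : MvPolynomial (Fin n) K) (F : Polynomial (MvPolynomial (Fin n) K)), D ≠ 0 ∧ F ≠ 0 ∧
    ContinuousOn f (S ∩ {x | MvPolynomial.aeval x D ≠ 0}) ∧
    ∀ x ∈ S, MvPolynomial.aeval x D ≠ 0 →
      Polynomial.eval₂ (MvPolynomial.aeval x : MvPolynomial (Fin n) K →ₐ[K] ℝ).toRingHom
        (f x) F = 0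

/-- The real numbers that are absolutely convergent integrals `∫_S f(x) dx₁ ⋯ dxₙ`, with `n ≥ 1`,
of a rational function `f` over `K` on a `K`-semialgebraic set `S ⊆ ℝⁿ`. -/
def rationalIntegrals : Set ℝ :=
  {a | ∃ (n : ℕ) (S : Set (Fin n → ℝ)) (f : (Fin n → ℝ) → ℝ), 1 ≤ n ∧
    IsSemialgebraic K S ∧ IsRationalFunction K f ∧
    MeasureTheory.IntegrableOn f S MeasureTheory.volume ∧
    a = ∫ x in S, f x ∂MeasureTheory.volume}

/-- The same with an algebraic function `f` over `K` on `S`. -/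
def algebraicIntegrals : Set ℝ :=
  {a | ∃ (n : ℕ) (S : Set (Fin n → ℝ)) (f : (Fin n → ℝ) → ℝ), 1 ≤ n ∧
    IsSemialgebraic K S ∧ IsAlgebraicFunctionOn K S f ∧
    MeasureTheory.IntegrableOn f S MeasureTheory.volume ∧
    a = ∫ x in S, f x ∂MeasureTheory.volume}

/-- Complex numbers whose real and imaginary parts are absolutely convergent integrals of rational
functions over `K` on `K`-semialgebraic sets. -/
def rationalPeriods : Set ℂ :=
  {z | z.re ∈ rationalIntegrals K ∧ z.im ∈ rationalIntegrals K}

/-- Complex numbers whose real and imaginary parts are absolutely convergent integrals of algebraic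
functions over `K` on `K`-semialgebraic sets. -/
def algebraicPeriods : Set ℂ :=
  {z | z.re ∈ algebraicIntegrals K ∧ z.im ∈ algebraicIntegrals K}

end

/-- Periods in the sense of Kontsevich and Zagier. -/
def periods : Set ℂ := rationalPeriods ℚ

end KZPeriod

/-!
Everything rests on a cylindrical decomposition of `ℝⁿ` into connected semialgebraic cells, in the
following form. Let `𝓕` be a finite family of polynomials in one variable `t` whose coefficients
are polynomials on `ℝⁿ`. Enlarge it to a finite family that is stable under `∂/∂t`, removal of
leading terms and pseudo-remainders (`exists_isPseudoClosed_superset`). Over any set `C` on which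
the leading coefficients of the family have constant signs, the real roots of its members are then
finitely many continuous semialgebraic functions on `C`, ordered in the same way at every point (a
member that vanishes identically over `C` is disregarded here), and the sign of each member at
`(x, t)` depends only on the position of `t` among the roots at `x` (`exists_isDelineation`). The proof adds the members in the order of increasing degree. A new
polynomial `f` is monotone in `t` between consecutive old roots, because `∂f/∂t` is an old member,
and its signs at the old roots are determined by those of pseudo-remainders, which are old members
too. So the existence of a root of `f` in a gap does not depend on the point of `C`. By induction on
`n`, one obtains finitely many connected semialgebraic cells adapted to any given polynomials
(`exists_isCellCover`). On a connected cell, a continuous function with values among the roots of a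
delineated polynomial is one of the root functions (`IsDelineation.exists_eqOn`). This is used
twice.

* A condition `P(x) ≥ 0` with real algebraic coefficients reads `R(x, α) ≥ 0` with `R` over `ℚ` and
  `α` a primitive element. The constant function `α` is a root of its minimal polynomial, hence a
  root function over each cell of a decomposition over `ℚ`, so that the sign of `R(x, α)` is
  constant on the cells (`isSemialgebraic_eval_algebraic`).
* An algebraic function `f` on `S` coincides on each cell with a root function, outside the zero set
  of a nonzero polynomial, which is negligible (`volume_aeval_eq_zero`). Hence the region of the
  `(t, x)` with `t * |t|` strictly between `0` and `f x` is semialgebraic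
  (`IsAlgebraicFunctionOn.exists_isSemialgebraic_graphRegion`). By Fubini's theorem the integral of
  `f` over `S` is the integral of the polynomial `2t` over this region
  (`integrableOn_graphRegion`), and the region is semialgebraic over `ℚ` by the first point.
-/

namespace KZPeriod

/-! ### Sign-preserving transfer of the values of a polynomial in one variable -/

section Gap

variable {ι : Type*} (s : Finset ι) (a : ι → ℝ) (t : ℝ)

/-- The real numbers that have the same position as `t` with respect to the finitely many points
`a i`, `i ∈ s`: either a single point, or an open interval between neighbouring points. -/
def gap : Set ℝ := {u | ∀ i ∈ s, SignType.sign (u - a i) = SignType.sign (t - a i)}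

variable {s a t}

lemma mem_gap_self : t ∈ gap s a t := fun _ _ => rfl

lemma sign_sub_eq_sign_sub_iff {a b c d : ℝ} :
    SignType.sign (a - b) = SignType.sign (c - d) ↔ (a < b ↔ c < d) ∧ (b < a ↔ d < c) := by
  rcases lt_trichotomy a b with h | h | h <;> rcases lt_trichotomy c d with h' | h' | h' <;>
    simp [h, h', sign_neg, sign_pos, sub_neg, sub_pos, h.not_gt, h'.not_gt]

lemma mem_gap_iff {u : ℝ} :
    u ∈ gap s a t ↔ ∀ i ∈ s, (u < a i ↔ t < a i) ∧ (a i < u ↔ a i < t) := by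
  simp only [gap, Set.mem_ofPred_eq, sign_sub_eq_sign_sub_iff]

lemma gap_eq_of_mem {u : ℝ} (hu : u ∈ gap s a t) : gap s a u = gap s a t := by
  ext v
  simp only [gap, Set.mem_ofPred_eq]
  exact forall₂_congr fun i hi => by rw [hu i hi]

lemma ne_of_mem_gap (ht : ∀ i ∈ s, t ≠ a i) {u : ℝ} (hu : u ∈ gap s a t) : ∀ i ∈ s, u ≠ a i := by
  intro i hi e
  have := hu i hi
  rw [e, sub_self, sign_zero, eq_comm, sign_eq_zero_iff, sub_eq_zero] at this
  exact ht i hi this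

lemma ordConnected_gap : (gap s a t).OrdConnected := by
  refine ⟨fun u hu v hv w hw i hi => ?_⟩
  have h1 : SignType.sign (u - a i) ≤ SignType.sign (w - a i) :=
    SignType.sign.monotone (by linarith [hw.1])
  have h2 : SignType.sign (w - a i) ≤ SignType.sign (v - a i) :=
    SignType.sign.monotone (by linarith [hw.2])
  exact le_antisymm (h2.trans (hv i hi).le) ((hu i hi).ge.trans h1)

lemma isOpen_gap (ht : ∀ i ∈ s, t ≠ a i) : IsOpen (gap s a t) := by
  have : gap s a t = ⋂ i ∈ s, {u | SignType.sign (u - a i) = SignType.sign (t - a i)} := by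
    ext u; simp [gap]
  rw [this]
  refine isOpen_biInter_finset fun i hi => ?_
  rcases lt_or_gt_of_ne (ht i hi) with h | h
  · have : {u | SignType.sign (u - a i) = SignType.sign (t - a i)} = Set.Iio (a i) := by
      ext u; simp [sign_neg (sub_neg.2 h), sign_eq_neg_one_iff]
    rw [this]; exact isOpen_Iio
  · have : {u | SignType.sign (u - a i) = SignType.sign (t - a i)} = Set.Ioi (a i) := by
      ext u; simp [sign_pos (sub_pos.2 h), sign_eq_one_iff]
    rw [this]; exact isOpen_Ioi

lemma strictMonoOn_of_derivative_pos {p : Polynomial ℝ} {G : Set ℝ} (hG : G.OrdConnected)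
    (h : ∀ u ∈ G, 0 < p.derivative.eval u) : StrictMonoOn (fun u => p.eval u) G :=
  strictMonoOn_of_deriv_pos hG.convex p.continuous.continuousOn
    fun u hu => by simpa using h u (interior_subset hu)

lemma exists_eval_eq_zero_of_sign {p : Polynomial ℝ} {G : Set ℝ} (hG : G.OrdConnected) {u v : ℝ}
    (hu : u ∈ G) (hv : v ∈ G) (h1 : p.eval u < 0) (h2 : 0 < p.eval v) :
    ∃ w ∈ G, p.eval w = 0 :=
  hG.isPreconnected.intermediate_value hu hv p.continuous.continuousOn ⟨h1.le, h2.le⟩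

lemma sign_eval_eq_of_forall_ne_zero {p : Polynomial ℝ} {G : Set ℝ} (hG : G.OrdConnected)
    (h : ∀ w ∈ G, p.eval w ≠ 0) {u v : ℝ} (hu : u ∈ G) (hv : v ∈ G) :
    SignType.sign (p.eval u) = SignType.sign (p.eval v) := by
  rcases lt_or_gt_of_ne (h u hu) with h1 | h1 <;> rcases lt_or_gt_of_ne (h v hv) with h2 | h2
  · rw [sign_neg h1, sign_neg h2]
  · obtain ⟨w, hw, h0⟩ := exists_eval_eq_zero_of_sign hG hu hv h1 h2
    exact absurd h0 (h w hw)
  · obtain ⟨w, hw, h0⟩ := exists_eval_eq_zero_of_sign hG hv hu h2 h1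
    exact absurd h0 (h w hw)
  · rw [sign_pos h1, sign_pos h2]

lemma sign_eval_eq_mul_sign_sub {p : Polynomial ℝ} {G : Set ℝ} (hG : G.OrdConnected)
    {σ : SignType} (hσ : σ ≠ 0) (hp : ∀ w ∈ G, SignType.sign (p.derivative.eval w) = σ) {z u : ℝ}
    (hz : z ∈ G) (hz0 : p.eval z = 0) (hu : u ∈ G) :
    SignType.sign (p.eval u) = σ * SignType.sign (u - z) := by
  wlog hσ1 : σ = 1 generalizing p σ
  · have hσ2 : σ = -1 := by revert hσ hσ1; cases σ <;> decide
    have := this (p := -p) (σ := 1) (by decide)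
      (fun v hv => by simp [Left.sign_neg, hp v hv, hσ2]) (by simpa using hz0) rfl
    rw [Polynomial.eval_neg, Left.sign_neg, one_mul] at this
    rw [hσ2, ← this, neg_one_mul, neg_neg]
  subst hσ1
  simp only [sign_eq_one_iff] at hp
  have hmono := strictMonoOn_of_derivative_pos hG hp
  rw [one_mul]
  rcases lt_trichotomy u z with h | rfl | h
  · have := hmono hu hz h
    simp only [hz0] at this
    rw [sign_neg this, sign_neg (sub_neg.2 h)]
  · rw [hz0, sub_self]
  · have := hmono hz hu h
    simp only [hz0] at this
    rw [sign_pos this, sign_pos (sub_pos.2 h)]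

/-- If `p` is increasing on the gap of `t` and takes a positive value there, this is visible at the
upper end of the gap: either this is a marked point, where the value is positive, or it is `+∞`.
Hence a polynomial `q` with the same signs at corresponding marked points, increasing on the
corresponding gap, takes a positive value on that gap as well. -/
lemma exists_pos_mem_gap {b : ι → ℝ} {p q : Polynomial ℝ} {u : ℝ}
    (hab : ∀ i ∈ s, ∀ j ∈ s, SignType.sign (a i - a j) = SignType.sign (b i - b j))
    (hpq : ∀ i ∈ s, SignType.sign (p.eval (a i)) = SignType.sign (q.eval (b i)))
    (htu : ∀ i ∈ s, SignType.sign (t - a i) = SignType.sign (u - b i))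
    (ht : ∀ i ∈ s, t ≠ a i)
    (hp : ∀ v ∈ gap s a t, 0 < p.derivative.eval v)
    (hq : ∀ v ∈ gap s b u, 0 < q.derivative.eval v) (hq0 : 0 < q.natDegree)
    (h : 0 < p.eval t) : ∃ v ∈ gap s b u, 0 < q.eval v := by
  classical
  simp only [sign_sub_eq_sign_sub_iff] at hab htu
  rcases (s.filter fun i => t < a i).eq_empty_or_nonempty with hU | hU
  · have hu : ∀ v, u ≤ v → v ∈ gap s b u := by
      intro v hv
      rw [mem_gap_iff]
      intro i hi
      have h1 : a i < t := lt_of_le_of_ne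
        (not_lt.1 fun h => (Finset.filter_eq_empty_iff.1 hU hi) h) (ht i hi).symm
      have h2 : b i < u := (htu i hi).2.1 h1
      constructor <;> constructor <;> intro <;> linarith
    rcases le_total 0 q.leadingCoeff with hl | hl
    · have h1 := q.tendsto_atTop_of_leadingCoeff_nonneg
        (Polynomial.natDegree_pos_iff_degree_pos.1 hq0) hl
      obtain ⟨v, hv, hv'⟩ := ((h1.eventually_gt_atTop 0).and (Filter.eventually_ge_atTop u)).exists
      exact ⟨v, hu v hv', hv⟩
    · have h1 := q.tendsto_atBot_of_leadingCoeff_nonpos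
        (Polynomial.natDegree_pos_iff_degree_pos.1 hq0) hl
      obtain ⟨v, hv, hv'⟩ :=
        ((h1.eventually_lt_atBot (q.eval u)).and (Filter.eventually_ge_atTop u)).exists
      exact absurd ((strictMonoOn_of_derivative_pos ordConnected_gap hq).monotoneOn
        mem_gap_self (hu v hv') hv') (not_le.2 hv)
  · obtain ⟨i, hi, himin⟩ := Finset.exists_min_image _ a hU
    simp only [Finset.mem_filter] at hi himin
    have hti := hi.2
    have hui : u < b i := (htu i hi.1).1.1 hti
    have h1 : ∀ v ∈ Set.Ioo t (a i), v ∈ gap s a t := by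
      intro v hv
      rw [mem_gap_iff]
      intro j hj
      rcases lt_or_gt_of_ne (ht j hj) with h | h
      · have := himin j ⟨hj, h⟩
        have := hv.1; have := hv.2
        constructor <;> constructor <;> intro <;> linarith
      · have := hv.1
        constructor <;> constructor <;> intro <;> linarith
    have h2 : p.eval t < p.eval (a i) := by
      refine strictMonoOn_of_deriv_pos (convex_Icc t (a i)) p.continuous.continuousOn
        (fun v hv => ?_) (Set.left_mem_Icc.2 hti.le) (Set.right_mem_Icc.2 hti.le) hti
      rw [interior_Icc] at hv
      simpa using hp v (h1 v hv)
    have h3 : 0 < q.eval (b i) := by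
      rw [← sign_eq_one_iff, ← hpq i hi.1, sign_eq_one_iff]; linarith
    have h4 : ∀ᶠ v in nhdsWithin (b i) (Set.Iio (b i)), 0 < q.eval v :=
      nhdsWithin_le_nhds (q.continuous.continuousAt.eventually_const_lt h3)
    obtain ⟨v, hv, hv'⟩ := (h4.and (Ioo_mem_nhdsLT hui)).exists
    refine ⟨v, mem_gap_iff.2 fun j hj => ?_, hv⟩
    have := hv'.1; have := hv'.2
    rcases lt_or_gt_of_ne (ht j hj) with h | h
    · have h5 := himin j ⟨hj, h⟩
      have h6 : b i ≤ b j := not_lt.1 fun h => (not_lt.2 h5) ((hab i hi.1 j hj).2.2 h)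
      constructor <;> constructor <;> intro <;> linarith
    · have h5 : b j < u := (htu j hj).2.1 h
      constructor <;> constructor <;> intro <;> linarith

/-- The mirror image of `exists_pos_mem_gap` under `t ↦ -t`. -/
lemma exists_neg_mem_gap {b : ι → ℝ} {p q : Polynomial ℝ} {u : ℝ}
    (hab : ∀ i ∈ s, ∀ j ∈ s, SignType.sign (a i - a j) = SignType.sign (b i - b j))
    (hpq : ∀ i ∈ s, SignType.sign (p.eval (a i)) = SignType.sign (q.eval (b i)))
    (htu : ∀ i ∈ s, SignType.sign (t - a i) = SignType.sign (u - b i))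
    (ht : ∀ i ∈ s, t ≠ a i)
    (hp : ∀ v ∈ gap s a t, 0 < p.derivative.eval v)
    (hq : ∀ v ∈ gap s b u, 0 < q.derivative.eval v) (hq0 : 0 < q.natDegree)
    (h : p.eval t < 0) : ∃ v ∈ gap s b u, q.eval v < 0 := by
  have key : ∀ x y : ℝ, SignType.sign (-x - -y) = -SignType.sign (x - y) := fun x y => by
    rw [← Left.sign_neg]; congr 1; ring
  have hg : ∀ (c : ι → ℝ) (w v : ℝ), v ∈ gap s (fun i => -c i) (-w) → -v ∈ gap s c w := by
    intro c w v hv i hi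
    have := hv i hi
    rw [key, ← neg_neg v, key] at this
    exact neg_injective this
  obtain ⟨v, hv, hv'⟩ := exists_pos_mem_gap (s := s) (a := fun i => -a i) (b := fun i => -b i)
    (p := -(p.comp (-Polynomial.X))) (q := -(q.comp (-Polynomial.X))) (t := -t) (u := -u)
    (fun i hi j hj => by rw [key, key, hab i hi j hj])
    (fun i hi => by simp [Left.sign_neg, hpq i hi])
    (fun i hi => by rw [key, key, htu i hi])
    (fun i hi h => ht i hi (neg_injective h))
    (fun v hv => by simpa [Polynomial.derivative_comp] using hp (-v) (hg a t v hv))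
    (fun v hv => by simpa [Polynomial.derivative_comp] using hq (-v) (hg b u v hv))
    (by simpa [Polynomial.natDegree_comp] using hq0) (by simpa using h)
  exact ⟨-v, hg b u v hv, by simpa using hv'⟩

/-- If `p` and `q` have the same signs at corresponding marked points, and their derivatives have
the same constant nonzero sign on corresponding gaps, then they take the same signs on these
gaps. -/
lemma exists_sign_eq_mem_gap {b : ι → ℝ} {p q : Polynomial ℝ} {u : ℝ} {σ : SignType} (hσ : σ ≠ 0)
    (hab : ∀ i ∈ s, ∀ j ∈ s, SignType.sign (a i - a j) = SignType.sign (b i - b j))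
    (hpq : ∀ i ∈ s, SignType.sign (p.eval (a i)) = SignType.sign (q.eval (b i)))
    (htu : ∀ i ∈ s, SignType.sign (t - a i) = SignType.sign (u - b i))
    (ht : ∀ i ∈ s, t ≠ a i)
    (hp : ∀ v ∈ gap s a t, SignType.sign (p.derivative.eval v) = σ)
    (hq : ∀ v ∈ gap s b u, SignType.sign (q.derivative.eval v) = σ) (hq0 : 0 < q.natDegree) :
    ∃ v ∈ gap s b u, SignType.sign (q.eval v) = SignType.sign (p.eval t) := by
  wlog hσ1 : σ = 1 generalizing p q σ
  · have hσ2 : σ = -1 := by revert hσ hσ1; cases σ <;> decide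
    obtain ⟨v, hv, h⟩ := this (p := -p) (q := -q) (σ := 1) (by decide)
      (fun i hi => by simp [Left.sign_neg, hpq i hi])
      (fun v hv => by simp [Left.sign_neg, hp v hv, hσ2])
      (fun v hv => by simp [Left.sign_neg, hq v hv, hσ2]) (by simpa using hq0) rfl
    exact ⟨v, hv, by simpa [Left.sign_neg] using h⟩
  subst hσ1
  simp only [sign_eq_one_iff] at hp hq
  rcases lt_trichotomy (p.eval t) 0 with h | h | h
  · obtain ⟨v, hv, h'⟩ := exists_neg_mem_gap hab hpq htu ht hp hq hq0 h
    exact ⟨v, hv, by rw [sign_neg h, sign_neg h']⟩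
  · obtain ⟨ε, hε, hball⟩ := Metric.isOpen_iff.1 (isOpen_gap ht) t mem_gap_self
    have hmono := strictMonoOn_of_derivative_pos ordConnected_gap hp
    have m1 : t - ε / 2 ∈ gap s a t := hball (by simp [abs_of_pos hε, hε])
    have m2 : t + ε / 2 ∈ gap s a t := hball (by simp [abs_of_pos hε, hε])
    have l1 : p.eval (t - ε / 2) < 0 := h ▸ hmono m1 mem_gap_self (by linarith)
    have l2 : 0 < p.eval (t + ε / 2) := by
      have := hmono mem_gap_self m2 (by linarith)
      simp only [h] at this
      exact this
    obtain ⟨v1, hv1, h1⟩ := exists_neg_mem_gap hab hpq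
      (fun i hi => (m1 i hi).trans (htu i hi)) (ne_of_mem_gap ht m1)
      (by rwa [gap_eq_of_mem m1]) hq hq0 l1
    obtain ⟨v2, hv2, h2⟩ := exists_pos_mem_gap hab hpq
      (fun i hi => (m2 i hi).trans (htu i hi)) (ne_of_mem_gap ht m2)
      (by rwa [gap_eq_of_mem m2]) hq hq0 l2
    obtain ⟨w, hw, h0⟩ := exists_eval_eq_zero_of_sign ordConnected_gap hv1 hv2 h1 h2
    exact ⟨w, hw, by rw [h, h0]⟩
  · obtain ⟨v, hv, h'⟩ := exists_pos_mem_gap hab hpq htu ht hp hq hq0 h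
    exact ⟨v, hv, by rw [sign_pos h, sign_pos h']⟩

end Gap

/-! ### Finite families of polynomials stable under derivatives and pseudo-remainders -/

section PseudoRemainder

variable {R : Type*} [CommRing R]

/-- Pseudo-division: after multiplication by a power of the leading coefficient of `g`, the
polynomial `f` can be divided by `g` with remainder. -/
lemma exists_pseudoRemainder {g : Polynomial R} (hg : 0 < g.natDegree) (f : Polynomial R) :
    ∃ r : Polynomial R, r.natDegree < g.natDegree ∧
      ∃ (k : ℕ) (q : Polynomial R), Polynomial.C (g.leadingCoeff ^ k) * f = g * q + r := by
  induction hd : f.natDegree using Nat.strong_induction_on generalizing f with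
  | _ d ih =>
    by_cases hfg : f.natDegree < g.natDegree
    · exact ⟨f, hfg, 0, 0, by simp⟩
    · push Not at hfg
      obtain ⟨r, hr, k, q, h⟩ := ih _
        (hd ▸ Polynomial.natDegree_cancelLeads_lt_of_natDegree_le_natDegree hfg (hg.trans_le hfg))
        _ rfl
      refine ⟨r, hr, k + 1, q + Polynomial.C (g.leadingCoeff ^ k) * (Polynomial.C f.leadingCoeff *
        Polynomial.X ^ (f.natDegree - g.natDegree)), ?_⟩
      rw [Polynomial.cancelLeads, Nat.sub_eq_zero_of_le hfg] at h
      rw [pow_succ, Polynomial.C_mul]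
      linear_combination h

/-- Stability of a finite family of polynomials, as far as members `g` of positive degree are
concerned, under differentiation, removal of the leading term, and taking a remainder of the
pseudo-division by `g` of members of at least the same degree. -/
def IsPseudoClosed (𝓕 : Finset (Polynomial R)) : Prop :=
  ∀ g ∈ 𝓕, 0 < g.natDegree → g.derivative ∈ 𝓕 ∧ g.eraseLead ∈ 𝓕 ∧
    ∀ f ∈ 𝓕, g.natDegree ≤ f.natDegree → ∃ r ∈ 𝓕, r.natDegree < g.natDegree ∧
      ∃ (k : ℕ) (q : Polynomial R), Polynomial.C (g.leadingCoeff ^ k) * f = g * q + r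

/-- Every finite family of polynomials is contained in a finite stable one: process the possible
degrees `j` of the divisor `g` in decreasing order; the polynomials added for `j` have degree less
than `j`, so that they do not affect the degrees already processed. -/
lemma exists_isPseudoClosed_superset (𝓕 : Finset (Polynomial R)) :
    ∃ 𝓖 : Finset (Polynomial R), 𝓕 ⊆ 𝓖 ∧ IsPseudoClosed 𝓖 := by
  classical
  have key : ∀ (j : ℕ) (𝓕 : Finset (Polynomial R)),
      (∀ g ∈ 𝓕, 0 < g.natDegree → j ≤ g.natDegree → g.derivative ∈ 𝓕 ∧ g.eraseLead ∈ 𝓕 ∧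
        ∀ f ∈ 𝓕, g.natDegree ≤ f.natDegree → ∃ r ∈ 𝓕, r.natDegree < g.natDegree ∧
          ∃ (k : ℕ) (q : Polynomial R), Polynomial.C (g.leadingCoeff ^ k) * f = g * q + r) →
      ∃ 𝓖 : Finset (Polynomial R), 𝓕 ⊆ 𝓖 ∧ IsPseudoClosed 𝓖 := by
    intro j
    induction j with
    | zero => exact fun 𝓕 h => ⟨𝓕, subset_rfl, fun g hg h0 => h g hg h0 (Nat.zero_le _)⟩
    | succ j ih =>
      intro 𝓕 h
      have hrem : ∀ g f : Polynomial R, ∃ r : Polynomial R, 0 < g.natDegree →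
          r.natDegree < g.natDegree ∧ ∃ (k : ℕ) (q : Polynomial R),
            Polynomial.C (g.leadingCoeff ^ k) * f = g * q + r := fun g f => by
        by_cases hg : 0 < g.natDegree
        · obtain ⟨r, hr⟩ := exists_pseudoRemainder hg f
          exact ⟨r, fun _ => hr⟩
        · exact ⟨0, fun h => absurd h hg⟩
      choose rem hrem using hrem
      let 𝓙 := 𝓕.filter fun g => 0 < g.natDegree ∧ g.natDegree = j
      let 𝓝 := 𝓙.image Polynomial.derivative ∪ 𝓙.image Polynomial.eraseLead ∪
        (𝓙 ×ˢ 𝓕).image fun p => rem p.1 p.2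
      have h𝓝 : ∀ g ∈ 𝓝, g.natDegree < j := by
        intro g hg
        simp only [𝓝, 𝓙, Finset.mem_union, Finset.mem_image, Finset.mem_filter,
          Finset.mem_product] at hg
        rcases hg with (⟨f, ⟨_, h0, rfl⟩, rfl⟩ | ⟨f, ⟨_, h0, rfl⟩, rfl⟩) |
          ⟨⟨g, f⟩, ⟨⟨_, h0, rfl⟩, _⟩, rfl⟩
        · exact Polynomial.natDegree_derivative_lt h0.ne'
        · have := f.eraseLead_natDegree_le; omega
        · exact (hrem g f h0).1
      obtain ⟨𝓖, h1, h2⟩ := ih (𝓕 ∪ 𝓝) (by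
        intro g hg h0 hj
        have hg𝓕 : g ∈ 𝓕 := (Finset.mem_union.1 hg).resolve_right fun h =>
          absurd (h𝓝 g h) (not_lt.2 hj)
        have hf𝓕 : ∀ f ∈ 𝓕 ∪ 𝓝, g.natDegree ≤ f.natDegree → f ∈ 𝓕 := fun f hf hgf =>
          (Finset.mem_union.1 hf).resolve_right fun h =>
            absurd (h𝓝 f h) (not_lt.2 (hj.trans hgf))
        rcases hj.lt_or_eq with hj | hj
        · obtain ⟨a1, a2, a3⟩ := h g hg𝓕 h0 hj
          refine ⟨Finset.mem_union_left _ a1, Finset.mem_union_left _ a2, fun f hf hgf => ?_⟩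
          obtain ⟨r, hr, h⟩ := a3 f (hf𝓕 f hf hgf) hgf
          exact ⟨r, Finset.mem_union_left _ hr, h⟩
        · have hg𝓙 : g ∈ 𝓙 := Finset.mem_filter.2 ⟨hg𝓕, h0, hj.symm⟩
          refine ⟨?_, ?_, fun f hf hgf => ⟨rem g f, ?_, hrem g f h0⟩⟩ <;>
            refine Finset.mem_union_right _ ?_ <;> simp only [𝓝, Finset.mem_union]
          · exact Or.inl (Or.inl (Finset.mem_image_of_mem _ hg𝓙))
          · exact Or.inl (Or.inr (Finset.mem_image_of_mem _ hg𝓙))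
          · exact Or.inr (Finset.mem_image.2
              ⟨(g, f), Finset.mem_product.2 ⟨hg𝓙, hf𝓕 f hf hgf⟩, rfl⟩))
      exact ⟨𝓖, Finset.union_subset_left h1, h2⟩
  refine key (𝓕.sup Polynomial.natDegree + 1) 𝓕 fun g hg _ h => ?_
  have := Finset.le_sup (f := Polynomial.natDegree) hg
  omega

end PseudoRemainder

/-! ### Semialgebraic sets -/

section Semialgebraic

variable {K : Type} [Field K] [Algebra K ℝ] {n : ℕ}

lemma isSemialgebraic_univ : IsSemialgebraic K (Set.univ : Set (Fin n → ℝ)) := by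
  have := IsSemialgebraic.nonneg (K := K) (0 : MvPolynomial (Fin n) K)
  simpa using this

lemma isSemialgebraic_empty : IsSemialgebraic K (∅ : Set (Fin n → ℝ)) := by
  simpa using (isSemialgebraic_univ (K := K) (n := n)).compl

lemma isSemialgebraic_neg (P : MvPolynomial (Fin n) K) :
    IsSemialgebraic K {x : Fin n → ℝ | MvPolynomial.aeval x P < 0} := by
  convert (IsSemialgebraic.nonneg P).compl using 1
  ext x; simp

lemma isSemialgebraic_pos (P : MvPolynomial (Fin n) K) :
    IsSemialgebraic K {x : Fin n → ℝ | 0 < MvPolynomial.aeval x P} := by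
  simpa using isSemialgebraic_neg (-P)

lemma isSemialgebraic_zero (P : MvPolynomial (Fin n) K) :
    IsSemialgebraic K {x : Fin n → ℝ | MvPolynomial.aeval x P = 0} := by
  convert ((isSemialgebraic_neg P).union _ _ (isSemialgebraic_pos P)).compl using 1
  ext x; simp [le_antisymm_iff, and_comm]

lemma isSemialgebraic_biUnion {ι : Type*} (s : Finset ι) {S : ι → Set (Fin n → ℝ)}
    (h : ∀ i ∈ s, IsSemialgebraic K (S i)) : IsSemialgebraic K (⋃ i ∈ s, S i) := by
  classical
  induction s using Finset.induction_on with
  | empty => simpa using isSemialgebraic_empty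
  | insert a s _ ih =>
    rw [Finset.set_biUnion_insert]
    exact (h a (Finset.mem_insert_self a s)).union _ _
      (ih fun i hi => h i (Finset.mem_insert_of_mem hi))

lemma isSemialgebraic_biInter {ι : Type*} (s : Finset ι) {S : ι → Set (Fin n → ℝ)}
    (h : ∀ i ∈ s, IsSemialgebraic K (S i)) : IsSemialgebraic K (⋂ i ∈ s, S i) := by
  classical
  induction s using Finset.induction_on with
  | empty => simpa using isSemialgebraic_univ
  | insert a s _ ih =>
    rw [Finset.set_biInter_insert]
    exact (h a (Finset.mem_insert_self a s)).inter _ _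
      (ih fun i hi => h i (Finset.mem_insert_of_mem hi))

lemma IsSemialgebraic.preimage {m : ℕ} {S : Set (Fin m → ℝ)} (hS : IsSemialgebraic K S)
    (φ : Fin m → MvPolynomial (Fin n) K) :
    IsSemialgebraic K {x : Fin n → ℝ | (fun i => MvPolynomial.aeval x (φ i)) ∈ S} := by
  induction hS with
  | nonneg P =>
    convert IsSemialgebraic.nonneg (MvPolynomial.bind₁ φ P) using 1
    ext x
    simp [MvPolynomial.aeval_bind₁]
  | union S T _ _ h1 h2 => exact h1.union _ _ h2
  | inter S T _ _ h1 h2 => exact h1.inter _ _ h2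
  | compl S _ h => exact h.compl

lemma continuous_aeval (P : MvPolynomial (Fin n) K) :
    Continuous fun x : Fin n → ℝ => MvPolynomial.aeval x P := by
  simp only [MvPolynomial.aeval_def, MvPolynomial.eval₂_eq_eval_map]
  exact MvPolynomial.continuous_eval _

lemma IsSemialgebraic.measurableSet {S : Set (Fin n → ℝ)} (hS : IsSemialgebraic K S) :
    MeasurableSet S := by
  induction hS with
  | nonneg P => exact measurableSet_le measurable_const (continuous_aeval P).measurable
  | union S T _ _ h1 h2 => exact h1.union h2
  | inter S T _ _ h1 h2 => exact h1.inter h2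
  | compl S _ h => exact h.compl

/-- Membership in a semialgebraic set depends only on the signs of finitely many polynomials. -/
lemma IsSemialgebraic.exists_sign_determined {S : Set (Fin n → ℝ)} (hS : IsSemialgebraic K S) :
    ∃ 𝓟 : Finset (MvPolynomial (Fin n) K), ∀ x y : Fin n → ℝ,
      (∀ P ∈ 𝓟, SignType.sign (MvPolynomial.aeval x P) = SignType.sign (MvPolynomial.aeval y P)) →
      (x ∈ S ↔ y ∈ S) := by
  classical
  induction hS with
  | nonneg P =>
    refine ⟨{P}, fun x y h => ?_⟩
    rw [Set.mem_ofPred_eq, Set.mem_ofPred_eq, ← sign_nonneg_iff, h P (by simp), sign_nonneg_iff]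
  | union S T _ _ h1 h2 =>
    obtain ⟨𝓟, h1⟩ := h1
    obtain ⟨𝓠, h2⟩ := h2
    exact ⟨𝓟 ∪ 𝓠, fun x y h => or_congr
      (h1 x y fun P hP => h P (Finset.mem_union_left _ hP))
      (h2 x y fun P hP => h P (Finset.mem_union_right _ hP))⟩
  | inter S T _ _ h1 h2 =>
    obtain ⟨𝓟, h1⟩ := h1
    obtain ⟨𝓠, h2⟩ := h2
    exact ⟨𝓟 ∪ 𝓠, fun x y h => and_congr
      (h1 x y fun P hP => h P (Finset.mem_union_left _ hP))
      (h2 x y fun P hP => h P (Finset.mem_union_right _ hP))⟩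
  | compl S _ h =>
    obtain ⟨𝓟, h⟩ := h
    exact ⟨𝓟, fun x y hxy => not_congr (h x y hxy)⟩

/-- The real polynomial in `t` obtained by evaluating the coefficients, which are polynomials on
`ℝⁿ`, at the point `x`. -/
noncomputable def specialize (x : Fin n → ℝ) :
    Polynomial (MvPolynomial (Fin n) K) →+* Polynomial ℝ :=
  Polynomial.mapRingHom (MvPolynomial.aeval x : MvPolynomial (Fin n) K →ₐ[K] ℝ).toRingHom

lemma specialize_apply (x : Fin n → ℝ) (p : Polynomial (MvPolynomial (Fin n) K)) :
    specialize x p =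
      p.map (MvPolynomial.aeval x : MvPolynomial (Fin n) K →ₐ[K] ℝ).toRingHom := rfl

@[simp] lemma specialize_X (x : Fin n → ℝ) :
    specialize x (Polynomial.X : Polynomial (MvPolynomial (Fin n) K)) = Polynomial.X := by
  simp [specialize]

@[simp] lemma specialize_C (x : Fin n → ℝ) (P : MvPolynomial (Fin n) K) :
    specialize x (Polynomial.C P) = Polynomial.C (MvPolynomial.aeval x P) := by
  simp [specialize]

lemma aeval_cons (t : ℝ) (x : Fin n → ℝ) (P : MvPolynomial (Fin (n + 1)) K) :
    MvPolynomial.aeval (Fin.cons t x : Fin (n + 1) → ℝ) P =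
      (specialize x (MvPolynomial.finSuccEquiv K n P)).eval t := by
  induction P using MvPolynomial.induction_on with
  | C a =>
    have : MvPolynomial.finSuccEquiv K n (MvPolynomial.C a) =
        Polynomial.C (MvPolynomial.C a) := by
      simp [MvPolynomial.finSuccEquiv_apply]
    simp [this]
  | add p q hp hq => simp [hp, hq]
  | mul_X p i hp =>
    rw [map_mul, map_mul, map_mul, Polynomial.eval_mul, hp]
    congr 1
    refine Fin.cases ?_ (fun j => ?_) i
    · simp [MvPolynomial.finSuccEquiv_X_zero]
    · simp [MvPolynomial.finSuccEquiv_X_succ]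

lemma continuous_specialize_eval (p : Polynomial (MvPolynomial (Fin n) K)) (t : ℝ) :
    Continuous fun x : Fin n → ℝ => (specialize x p).eval t := by
  simp only [specialize_apply, Polynomial.eval_map, Polynomial.eval₂_eq_sum_range]
  exact continuous_finsetSum _ fun i _ => (continuous_aeval _).mul continuous_const

lemma sign_specialize_eval_isSemialgebraic (p : Polynomial (MvPolynomial (Fin n) K))
    (σ : SignType) : IsSemialgebraic K {z : Fin (n + 1) → ℝ |
      SignType.sign ((specialize (Fin.tail z) p).eval (z 0)) = σ} := by
  have key : ∀ z : Fin (n + 1) → ℝ, (specialize (Fin.tail z) p).eval (z 0) =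
      MvPolynomial.aeval z ((MvPolynomial.finSuccEquiv K n).symm p) := fun z => by
    conv_rhs => rw [← Fin.cons_self_tail z, aeval_cons]
    simp
  simp only [key]
  rcases σ with _ | _ | _
  · simpa [SignType.zero_eq_zero] using isSemialgebraic_zero _
  · simpa [SignType.neg_eq_neg_one, sign_eq_neg_one_iff] using isSemialgebraic_neg _
  · simpa [SignType.pos_eq_one, sign_eq_one_iff] using isSemialgebraic_pos _

end Semialgebraic

/-! ### Delineation of a family of polynomials in one variable with parameters -/

section Delineation

variable {K : Type} [Field K] [Algebra K ℝ] {n : ℕ}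

variable (K) in
/-- A relation between points `x` of `C ⊆ ℝⁿ` and real numbers `t` is `K`-semialgebraic over `C` if
it is induced by a `K`-semialgebraic subset of `ℝⁿ⁺¹`. No condition is put on `C`. -/
def IsSemialgebraicOver (C : Set (Fin n → ℝ)) (r : (Fin n → ℝ) → ℝ → Prop) : Prop :=
  ∃ W : Set (Fin (n + 1) → ℝ), IsSemialgebraic K W ∧
    ∀ x ∈ C, ∀ t : ℝ, (Fin.cons t x : Fin (n + 1) → ℝ) ∈ W ↔ r x t

namespace IsSemialgebraicOver

variable {C : Set (Fin n → ℝ)} {r r' : (Fin n → ℝ) → ℝ → Prop}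

lemma congr (h : IsSemialgebraicOver K C r) (hr : ∀ x ∈ C, ∀ t, r' x t ↔ r x t) :
    IsSemialgebraicOver K C r' := by
  obtain ⟨W, hW, h⟩ := h
  exact ⟨W, hW, fun x hx t => (h x hx t).trans (hr x hx t).symm⟩

lemma not (h : IsSemialgebraicOver K C r) : IsSemialgebraicOver K C fun x t => ¬ r x t := by
  obtain ⟨W, hW, h⟩ := h
  exact ⟨Wᶜ, hW.compl, fun x hx t => not_congr (h x hx t)⟩

lemma and (h : IsSemialgebraicOver K C r) (h' : IsSemialgebraicOver K C r') :
    IsSemialgebraicOver K C fun x t => r x t ∧ r' x t := by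
  obtain ⟨W, hW, h⟩ := h
  obtain ⟨W', hW', h'⟩ := h'
  exact ⟨W ∩ W', hW.inter _ _ hW', fun x hx t => and_congr (h x hx t) (h' x hx t)⟩

lemma or (h : IsSemialgebraicOver K C r) (h' : IsSemialgebraicOver K C r') :
    IsSemialgebraicOver K C fun x t => r x t ∨ r' x t := by
  obtain ⟨W, hW, h⟩ := h
  obtain ⟨W', hW', h'⟩ := h'
  exact ⟨W ∪ W', hW.union _ _ hW', fun x hx t => or_congr (h x hx t) (h' x hx t)⟩

lemma forall_mem {ι : Type*} (s : Finset ι) {r : ι → (Fin n → ℝ) → ℝ → Prop}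
    (h : ∀ i ∈ s, IsSemialgebraicOver K C (r i)) :
    IsSemialgebraicOver K C fun x t => ∀ i ∈ s, r i x t := by
  choose! W hW h using h
  exact ⟨⋂ i ∈ s, W i, isSemialgebraic_biInter s hW, fun x hx t => by
    simp only [Set.mem_iInter]
    exact forall₂_congr fun i hi => h i hi x hx t⟩

lemma exists_mem {ι : Type*} (s : Finset ι) {r : ι → (Fin n → ℝ) → ℝ → Prop}
    (h : ∀ i ∈ s, IsSemialgebraicOver K C (r i)) :
    IsSemialgebraicOver K C fun x t => ∃ i ∈ s, r i x t :=
  (forall_mem s fun i hi => (h i hi).not).not.congr fun x _ t => by simp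

lemma sign_sub {ξ : (Fin n → ℝ) → ℝ} (h : IsSemialgebraicOver K C fun x t => t < ξ x)
    (h' : IsSemialgebraicOver K C fun x t => t = ξ x) (σ : SignType) :
    IsSemialgebraicOver K C fun x t => SignType.sign (t - ξ x) = σ := by
  rcases σ with _ | _ | _
  · exact h'.congr fun x _ t => by simp [SignType.zero_eq_zero, sub_eq_zero]
  · exact h.congr fun x _ t => by simp [SignType.neg_eq_neg_one, sign_eq_neg_one_iff]
  · exact (h.or h').not.congr fun x _ t => by
      rw [SignType.pos_eq_one, sign_eq_one_iff, sub_pos, ← le_iff_lt_or_eq, not_le]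

lemma sign_eval (p : Polynomial (MvPolynomial (Fin n) K)) (σ : SignType) :
    IsSemialgebraicOver K C fun x t => SignType.sign ((specialize x p).eval t) = σ :=
  ⟨_, sign_specialize_eval_isSemialgebraic p σ, fun x _ t => by simp⟩

lemma isSemialgebraic (h : IsSemialgebraicOver K C r) (hC : IsSemialgebraic K C) :
    IsSemialgebraic K {z : Fin (n + 1) → ℝ | Fin.tail z ∈ C ∧ r (Fin.tail z) (z 0)} := by
  obtain ⟨W, hW, h⟩ := h
  have h1 : IsSemialgebraic K {z : Fin (n + 1) → ℝ | Fin.tail z ∈ C} := by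
    convert hC.preimage (fun i : Fin n => (MvPolynomial.X i.succ : MvPolynomial (Fin (n + 1)) K))
      using 2
    simp [Fin.tail_def]
  convert h1.inter _ _ hW using 1
  ext z
  simp only [Set.mem_ofPred_eq, Set.mem_inter_iff]
  refine and_congr_right fun hz => ?_
  rw [← h _ hz, Fin.cons_self_tail]

end IsSemialgebraicOver

/-- The functions `ξ ∈ Ξ` delineate the family `𝓕` of polynomials in `t` over the set `C` of
parameters: they are continuous and semialgebraic, ordered over all points of `C` in the same way,
each of them is a root of a member of `𝓕`, and the signs of the members of `𝓕` at `(x, t)` depend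
only on the position of `t` with respect to the numbers `ξ x`. -/
structure IsDelineation (C : Set (Fin n → ℝ)) (Ξ : Finset ((Fin n → ℝ) → ℝ))
    (𝓕 : Finset (Polynomial (MvPolynomial (Fin n) K))) : Prop where
  continuousOn : ∀ ξ ∈ Ξ, ContinuousOn ξ C
  lt : ∀ ξ ∈ Ξ, IsSemialgebraicOver K C fun x t => t < ξ x
  eq : ∀ ξ ∈ Ξ, IsSemialgebraicOver K C fun x t => t = ξ x
  sign_sub : ∀ ξ ∈ Ξ, ∀ η ∈ Ξ, ∀ x ∈ C, ∀ y ∈ C,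
    SignType.sign (ξ x - η x) = SignType.sign (ξ y - η y)
  sign_eval : ∀ p ∈ 𝓕, ∀ x ∈ C, ∀ y ∈ C, ∀ t u : ℝ,
    (∀ ξ ∈ Ξ, SignType.sign (t - ξ x) = SignType.sign (u - ξ y)) →
    SignType.sign ((specialize x p).eval t) = SignType.sign ((specialize y p).eval u)
  root : ∀ ξ ∈ Ξ, ∃ p ∈ 𝓕, 0 < p.natDegree ∧
    ∀ x ∈ C, MvPolynomial.aeval x p.leadingCoeff ≠ 0 ∧ (specialize x p).eval (ξ x) = 0

namespace IsDelineation

variable {C : Set (Fin n → ℝ)} {Ξ : Finset ((Fin n → ℝ) → ℝ)}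
  {𝓕 : Finset (Polynomial (MvPolynomial (Fin n) K))}

/-- Every position with respect to `Ξ` that occurs over some point of `C` is taken by a continuous
function on `C`. -/
lemma exists_section (h : IsDelineation C Ξ 𝓕) {x₀ : Fin n → ℝ} (hx₀ : x₀ ∈ C) (t₀ : ℝ) :
    ∃ τ : (Fin n → ℝ) → ℝ, ContinuousOn τ C ∧
      ∀ x ∈ C, ∀ ξ ∈ Ξ, SignType.sign (τ x - ξ x) = SignType.sign (t₀ - ξ x₀) := by
  classical
  by_cases hΞ : ∃ η ∈ Ξ, η x₀ = t₀
  · obtain ⟨η, hη, rfl⟩ := hΞ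
    exact ⟨η, h.continuousOn η hη, fun x hx ξ hξ => h.sign_sub η hη ξ hξ x hx x₀ hx₀⟩
  push Not at hΞ
  have hle : ∀ ξ ∈ Ξ, ∀ η ∈ Ξ, ξ x₀ ≤ η x₀ → ∀ x ∈ C, ξ x ≤ η x := by
    intro ξ hξ η hη hle x hx
    have := (sign_sub_eq_sign_sub_iff.1 (h.sign_sub ξ hξ η hη x hx x₀ hx₀)).2
    exact not_lt.1 fun h' => not_lt.2 hle (this.1 h')
  -- The function `τ` lies between the largest function below `t₀` and the smallest one above.
  suffices ∃ τ : (Fin n → ℝ) → ℝ, ContinuousOn τ C ∧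
      ∀ x ∈ C, ∀ ξ ∈ Ξ, (ξ x₀ < t₀ → ξ x < τ x) ∧ (t₀ < ξ x₀ → τ x < ξ x) by
    obtain ⟨τ, hτ, hτ'⟩ := this
    refine ⟨τ, hτ, fun x hx ξ hξ => ?_⟩
    obtain ⟨h1, h2⟩ := hτ' x hx ξ hξ
    rcases lt_or_gt_of_ne (hΞ ξ hξ) with h3 | h3
    · rw [sign_pos (sub_pos.2 h3), sign_pos (sub_pos.2 (h1 h3))]
    · rw [sign_neg (sub_neg.2 h3), sign_neg (sub_neg.2 (h2 h3))]
  rcases (Ξ.filter fun ξ => ξ x₀ < t₀).eq_empty_or_nonempty with hL | hL <;>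
    rcases (Ξ.filter fun ξ => t₀ < ξ x₀).eq_empty_or_nonempty with hU | hU
  · exact ⟨fun _ => 0, continuousOn_const, fun x hx ξ hξ =>
      ⟨fun h' => absurd h' (Finset.filter_eq_empty_iff.1 hL hξ),
        fun h' => absurd h' (Finset.filter_eq_empty_iff.1 hU hξ)⟩⟩
  · obtain ⟨η, hη, hmin⟩ := Finset.exists_min_image _ (fun ξ => ξ x₀) hU
    simp only [Finset.mem_filter] at hη hmin
    exact ⟨fun x => η x - 1, (h.continuousOn η hη.1).sub continuousOn_const, fun x hx ξ hξ =>
      ⟨fun h' => absurd h' (Finset.filter_eq_empty_iff.1 hL hξ), fun h' => by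
        linarith [hle η hη.1 ξ hξ (hmin ξ ⟨hξ, h'⟩) x hx]⟩⟩
  · obtain ⟨η, hη, hmax⟩ := Finset.exists_max_image _ (fun ξ => ξ x₀) hL
    simp only [Finset.mem_filter] at hη hmax
    exact ⟨fun x => η x + 1, (h.continuousOn η hη.1).add continuousOn_const, fun x hx ξ hξ =>
      ⟨fun h' => by linarith [hle ξ hξ η hη.1 (hmax ξ ⟨hξ, h'⟩) x hx],
        fun h' => absurd h' (Finset.filter_eq_empty_iff.1 hU hξ)⟩⟩
  · obtain ⟨η, hη, hmax⟩ := Finset.exists_max_image _ (fun ξ => ξ x₀) hL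
    obtain ⟨η', hη', hmin⟩ := Finset.exists_min_image _ (fun ξ => ξ x₀) hU
    simp only [Finset.mem_filter] at hη hmax hη' hmin
    have hlt : ∀ x ∈ C, η x < η' x := fun x hx =>
      (sign_sub_eq_sign_sub_iff.1 (h.sign_sub η hη.1 η' hη'.1 x hx x₀ hx₀)).1.2
        (hη.2.trans hη'.2)
    exact ⟨fun x => (η x + η' x) / 2,
      ((h.continuousOn η hη.1).add (h.continuousOn η' hη'.1)).div_const 2, fun x hx ξ hξ =>
      ⟨fun h' => by linarith [hle ξ hξ η hη.1 (hmax ξ ⟨hξ, h'⟩) x hx, hlt x hx],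
        fun h' => by linarith [hle η' hη'.1 ξ hξ (hmin ξ ⟨hξ, h'⟩) x hx, hlt x hx]⟩⟩

lemma exists_eq_of_root (h : IsDelineation C Ξ 𝓕) {p : Polynomial (MvPolynomial (Fin n) K)}
    (hp : p ∈ 𝓕) {x : Fin n → ℝ} (hx : x ∈ C) (hp0 : specialize x p ≠ 0) {t : ℝ}
    (ht : (specialize x p).eval t = 0) : ∃ ξ ∈ Ξ, t = ξ x := by
  by_contra! hΞ
  refine hp0 (Polynomial.eq_zero_of_infinite_isRoot _ ?_)
  refine (infinite_of_mem_nhds t ((isOpen_gap (s := Ξ) (a := fun ξ => ξ x) hΞ).mem_nhds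
    mem_gap_self)).mono fun u hu => ?_
  have := h.sign_eval p hp x hx x hx u t hu
  rwa [ht, sign_zero, sign_eq_zero_iff] at this

end IsDelineation

lemma natDegree_specialize {p : Polynomial (MvPolynomial (Fin n) K)} {x : Fin n → ℝ}
    (h : MvPolynomial.aeval x p.leadingCoeff ≠ 0) : (specialize x p).natDegree = p.natDegree :=
  Polynomial.natDegree_map_of_leadingCoeff_ne_zero _ h

lemma derivative_specialize (p : Polynomial (MvPolynomial (Fin n) K)) (x : Fin n → ℝ) :
    (specialize x p).derivative = specialize x p.derivative :=
  Polynomial.derivative_map _ _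

/-- A root of `f` in a gap of a delineation of a family that contains `∂f/∂t` propagates to a
continuous semialgebraic root function on the whole of `C`. The gap is described by the sign vector
`s`. -/
lemma IsDelineation.exists_root_function {C : Set (Fin n → ℝ)} {Ξ : Finset ((Fin n → ℝ) → ℝ)}
    {𝓕 : Finset (Polynomial (MvPolynomial (Fin n) K))} (h : IsDelineation C Ξ 𝓕)
    {f : Polynomial (MvPolynomial (Fin n) K)} (hf : 0 < f.natDegree)
    (hlead : ∀ x ∈ C, MvPolynomial.aeval x f.leadingCoeff ≠ 0) (hder : f.derivative ∈ 𝓕)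
    (hsign : ∀ ξ ∈ Ξ, ∀ x ∈ C, ∀ y ∈ C, SignType.sign ((specialize x f).eval (ξ x)) =
      SignType.sign ((specialize y f).eval (ξ y)))
    {s : ((Fin n → ℝ) → ℝ) → SignType} (hs : ∀ ξ ∈ Ξ, s ξ ≠ 0)
    (hroot : ∃ x ∈ C, ∃ t, (∀ ξ ∈ Ξ, SignType.sign (t - ξ x) = s ξ) ∧
      (specialize x f).eval t = 0) :
    ∃ (z : (Fin n → ℝ) → ℝ) (σ : SignType), ContinuousOn z C ∧
      (IsSemialgebraicOver K C fun x t => t < z x) ∧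
      (IsSemialgebraicOver K C fun x t => t = z x) ∧
      (∀ x ∈ C, ∀ ξ ∈ Ξ, SignType.sign (z x - ξ x) = s ξ) ∧
      ∀ x ∈ C, ∀ t, (∀ ξ ∈ Ξ, SignType.sign (t - ξ x) = s ξ) →
        SignType.sign ((specialize x f).eval t) = σ * SignType.sign (t - z x) := by
  classical
  obtain ⟨x₀, hx₀, t₀, ht₀, hr₀⟩ := hroot
  have hne : ∀ x t, (∀ ξ ∈ Ξ, SignType.sign (t - ξ x) = s ξ) → ∀ ξ ∈ Ξ, t ≠ ξ x := by
    rintro x t ht ξ hξ rfl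
    exact hs ξ hξ (by rw [← ht ξ hξ, sub_self, sign_zero])
  have hgap : ∀ x t, (∀ ξ ∈ Ξ, SignType.sign (t - ξ x) = s ξ) → ∀ u,
      u ∈ gap Ξ (fun ξ => ξ x) t ↔ ∀ ξ ∈ Ξ, SignType.sign (u - ξ x) = s ξ := by
    intro x t ht u
    simp only [gap, Set.mem_ofPred_eq]
    exact forall₂_congr fun ξ hξ => by rw [ht ξ hξ]
  set σ := SignType.sign ((specialize x₀ f.derivative).eval t₀) with hσdef
  have hder0 : ∀ x ∈ C, specialize x f.derivative ≠ 0 := by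
    intro x hx h0
    rw [← derivative_specialize] at h0
    have := Polynomial.derivative_eq_zero.1 h0
    rw [natDegree_specialize (hlead x hx)] at this
    omega
  have hσ : σ ≠ 0 := by
    intro h0
    obtain ⟨ξ, hξ, e⟩ := h.exists_eq_of_root hder hx₀ (hder0 x₀ hx₀) (sign_eq_zero_iff.1 h0)
    exact hne x₀ t₀ ht₀ ξ hξ e
  have hσ' : ∀ x ∈ C, ∀ t, (∀ ξ ∈ Ξ, SignType.sign (t - ξ x) = s ξ) →
      SignType.sign ((specialize x f).derivative.eval t) = σ := by
    intro x hx t ht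
    rw [derivative_specialize]
    exact h.sign_eval _ hder x hx x₀ hx₀ t t₀ fun ξ hξ => by rw [ht ξ hξ, ht₀ ξ hξ]
  have hex : ∀ x, ∃ z, x ∈ C → (∀ ξ ∈ Ξ, SignType.sign (z - ξ x) = s ξ) ∧
      (specialize x f).eval z = 0 := by
    intro x
    by_cases hx : x ∈ C
    · obtain ⟨τ, -, hτ⟩ := h.exists_section hx₀ t₀
      have hτx : ∀ ξ ∈ Ξ, SignType.sign (τ x - ξ x) = s ξ := fun ξ hξ => by
        rw [hτ x hx ξ hξ, ht₀ ξ hξ]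
      obtain ⟨v, hv, hv0⟩ := exists_sign_eq_mem_gap (s := Ξ) (a := fun ξ => ξ x₀)
        (b := fun ξ => ξ x) (p := specialize x₀ f) (q := specialize x f) (t := t₀) (u := τ x) hσ
        (fun ξ hξ η hη => h.sign_sub ξ hξ η hη x₀ hx₀ x hx)
        (fun ξ hξ => hsign ξ hξ x₀ hx₀ x hx) (fun ξ hξ => (hτ x hx ξ hξ).symm)
        (hne x₀ t₀ ht₀) (fun v hv => hσ' x₀ hx₀ v ((hgap x₀ t₀ ht₀ v).1 hv))
        (fun v hv => hσ' x hx v ((hgap x _ hτx v).1 hv))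
        (by rwa [natDegree_specialize (hlead x hx)])
      rw [hr₀, sign_zero, sign_eq_zero_iff] at hv0
      exact ⟨v, fun _ => ⟨(hgap x _ hτx v).1 hv, hv0⟩⟩
    · exact ⟨0, fun h => absurd h hx⟩
  choose z hz using hex
  have key : ∀ x ∈ C, ∀ t, (∀ ξ ∈ Ξ, SignType.sign (t - ξ x) = s ξ) →
      SignType.sign ((specialize x f).eval t) = σ * SignType.sign (t - z x) := by
    intro x hx t ht
    exact sign_eval_eq_mul_sign_sub (ordConnected_gap (s := Ξ) (a := fun ξ => ξ x) (t := z x)) hσ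
      (fun w hw => hσ' x hx w ((hgap x _ (hz x hx).1 w).1 hw)) mem_gap_self (hz x hx).2
      ((hgap x _ (hz x hx).1 t).2 ht)
  have hlt : ∀ x ∈ C, ∀ t, (∀ ξ ∈ Ξ, SignType.sign (t - ξ x) = s ξ) →
      (t < z x ↔ SignType.sign ((specialize x f).eval t) = -σ) := by
    intro x hx t ht
    rw [key x hx t ht, ← sub_neg, ← sign_eq_neg_one_iff]
    generalize SignType.sign (t - z x) = ε
    revert hσ
    generalize σ = σ
    revert ε σ
    decide
  have hgt : ∀ x ∈ C, ∀ t, (∀ ξ ∈ Ξ, SignType.sign (t - ξ x) = s ξ) →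
      (z x < t ↔ SignType.sign ((specialize x f).eval t) = σ) := by
    intro x hx t ht
    rw [key x hx t ht, ← sub_pos, ← sign_eq_one_iff]
    generalize SignType.sign (t - z x) = ε
    revert hσ
    generalize σ = σ
    revert ε σ
    decide
  have heq : ∀ x ∈ C, ∀ t, (∀ ξ ∈ Ξ, SignType.sign (t - ξ x) = s ξ) →
      (t = z x ↔ SignType.sign ((specialize x f).eval t) = 0) := by
    intro x hx t ht
    rw [key x hx t ht, ← sub_eq_zero, ← sign_eq_zero_iff]
    generalize SignType.sign (t - z x) = ε
    revert hσ
    generalize σ = σ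
    revert ε σ
    decide
  have hgapSA : IsSemialgebraicOver K C fun x t => ∀ ξ ∈ Ξ, SignType.sign (t - ξ x) = s ξ :=
    IsSemialgebraicOver.forall_mem Ξ fun ξ hξ => (h.lt ξ hξ).sign_sub (h.eq ξ hξ) (s ξ)
  refine ⟨z, σ, fun x hx => ?_, ?_, ?_, fun x hx => (hz x hx).1, key⟩
  · -- A number `t` in the gap with `t < z x` or `z x < t` has this property at all nearby points.
    have hev : ∀ g : (Fin n → ℝ) → ℝ, ContinuousWithinAt g C x → g x ≠ 0 →
        ∀ᶠ y in nhdsWithin x C, SignType.sign (g y) = SignType.sign (g x) := fun g hg h0 =>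
      ((continuousAt_sign_of_ne_zero h0).comp_continuousWithinAt hg).eventually
        (p := fun ε => ε = SignType.sign (g x)) (by rw [nhds_discrete]; simp)
    have hnhds : ∀ t, (∀ ξ ∈ Ξ, SignType.sign (t - ξ x) = s ξ) → t ≠ z x →
        ∀ᶠ y in nhdsWithin x C, y ∈ C ∧ (∀ ξ ∈ Ξ, SignType.sign (t - ξ y) = s ξ) ∧
          SignType.sign ((specialize y f).eval t) = SignType.sign ((specialize x f).eval t) := by
      intro t ht hne'
      refine Filter.Eventually.and self_mem_nhdsWithin (Filter.Eventually.and ?_ ?_)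
      · rw [Filter.eventually_all_finset]
        intro ξ hξ
        rw [← ht ξ hξ]
        exact hev (fun y => t - ξ y) (continuousWithinAt_const.sub (h.continuousOn ξ hξ x hx))
          (sub_ne_zero.2 (hne x t ht ξ hξ))
      · refine hev _ (continuous_specialize_eval f t).continuousWithinAt fun h0 => ?_
        exact hne' ((heq x hx t ht).2 (by rw [h0, sign_zero]))
    have hopen : {t | ∀ ξ ∈ Ξ, SignType.sign (t - ξ x) = s ξ} ∈ nhds (z x) := by
      refine Filter.mem_of_superset ((isOpen_gap (hne x _ (hz x hx).1)).mem_nhds mem_gap_self) ?_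
      exact fun u hu => (hgap x _ (hz x hx).1 u).1 hu
    refine tendsto_order.2 ⟨fun a ha => ?_, fun a ha => ?_⟩
    · obtain ⟨t, ht, hta⟩ := (Filter.inter_mem (nhdsWithin_le_nhds (s := Set.Iio (z x)) hopen)
        (Ioo_mem_nhdsLT ha) |> Filter.nonempty_of_mem)
      filter_upwards [hnhds t ht hta.2.ne] with y hy
      exact hta.1.trans ((hlt y hy.1 t hy.2.1).2 (hy.2.2.trans ((hlt x hx t ht).1 hta.2)))
    · obtain ⟨t, ht, hta⟩ := (Filter.inter_mem (nhdsWithin_le_nhds (s := Set.Ioi (z x)) hopen)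
        (Ioo_mem_nhdsGT ha) |> Filter.nonempty_of_mem)
      filter_upwards [hnhds t ht hta.1.ne'] with y hy
      exact ((hgt y hy.1 t hy.2.1).2 (hy.2.2.trans ((hgt x hx t ht).1 hta.1))).trans hta.2
  · refine ((IsSemialgebraicOver.exists_mem (Ξ.filter fun ξ => s ξ = 1)
      (r := fun ξ x t => ¬ ξ x < t) fun ξ hξ => ?_).or
      (hgapSA.and (IsSemialgebraicOver.sign_eval f (-σ)))).congr
      fun x hx t => ⟨fun h' => ?_, ?_⟩
    · have hξ := (Finset.mem_filter.1 hξ).1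
      exact ((h.lt ξ hξ).or (h.eq ξ hξ)).congr fun x _ t => by rw [← le_iff_lt_or_eq, not_lt]
    · by_cases hL : ∃ ξ ∈ Ξ.filter fun ξ => s ξ = 1, ¬ ξ x < t
      · exact Or.inl hL
      · push Not at hL
        have hg : ∀ ξ ∈ Ξ, SignType.sign (t - ξ x) = s ξ := by
          intro ξ hξ
          have h1 := (hz x hx).1 ξ hξ
          by_cases h2 : s ξ = 1
          · rw [h2, sign_eq_one_iff, sub_pos]
            exact hL ξ (Finset.mem_filter.2 ⟨hξ, h2⟩)
          · have h3 : s ξ = -1 := by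
              have := hs ξ hξ
              revert this h2
              cases s ξ <;> decide
            rw [h3, sign_eq_neg_one_iff] at h1 ⊢
            linarith
        exact Or.inr ⟨hg, (hlt x hx t hg).1 h'⟩
    · rintro (⟨ξ, hξ, h'⟩ | ⟨hg, h'⟩)
      · obtain ⟨hξ, h1⟩ := Finset.mem_filter.1 hξ
        have h2 := (hz x hx).1 ξ hξ
        rw [h1, sign_eq_one_iff] at h2
        linarith
      · exact (hlt x hx t hg).2 h'
  · refine (hgapSA.and (IsSemialgebraicOver.sign_eval f 0)).congr fun x hx t =>
      ⟨?_, fun h' => (heq x hx t h'.1).2 h'.2⟩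
    rintro rfl
    exact ⟨(hz x hx).1, by rw [(hz x hx).2, sign_zero]⟩

end Delineation

/-! ### Existence of delineations -/

section ExistsDelineation

variable {K : Type} [Field K] [Algebra K ℝ] {n : ℕ} {C : Set (Fin n → ℝ)}
  {Ξ : Finset ((Fin n → ℝ) → ℝ)} {𝓕 : Finset (Polynomial (MvPolynomial (Fin n) K))}

open scoped Classical in
/-- Adding a polynomial whose signs are already controlled by the delineation. -/
lemma IsDelineation.insert_of_sign_eval (h : IsDelineation C Ξ 𝓕)
    {f : Polynomial (MvPolynomial (Fin n) K)}
    (hf : ∀ x ∈ C, ∀ y ∈ C, ∀ t u : ℝ,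
      (∀ ξ ∈ Ξ, SignType.sign (t - ξ x) = SignType.sign (u - ξ y)) →
      SignType.sign ((specialize x f).eval t) = SignType.sign ((specialize y f).eval u)) :
    IsDelineation C Ξ (insert f 𝓕) where
  continuousOn := h.continuousOn
  lt := h.lt
  eq := h.eq
  sign_sub := h.sign_sub
  sign_eval p hp := by
    rcases Finset.mem_insert.1 hp with rfl | hp
    · exact hf
    · exact h.sign_eval p hp
  root ξ hξ := by
    obtain ⟨p, hp, h⟩ := h.root ξ hξ
    exact ⟨p, Finset.mem_insert_of_mem hp, h⟩

open scoped Classical in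
/-- Adding a polynomial `f` of positive degree whose leading coefficient has no zeros, once its
derivative belongs to the family and its signs at the functions of the delineation are constant:
the delineation has to be enlarged by the at most one root of `f` in each gap. -/
lemma IsDelineation.exists_insert (h : IsDelineation C Ξ 𝓕)
    {f : Polynomial (MvPolynomial (Fin n) K)} (hf : 0 < f.natDegree)
    (hlead : ∀ x ∈ C, MvPolynomial.aeval x f.leadingCoeff ≠ 0) (hder : f.derivative ∈ 𝓕)
    (hsign : ∀ ξ ∈ Ξ, ∀ x ∈ C, ∀ y ∈ C, SignType.sign ((specialize x f).eval (ξ x)) =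
      SignType.sign ((specialize y f).eval (ξ y))) :
    ∃ Ξ', IsDelineation C Ξ' (insert f 𝓕) := by
  -- A gap is encoded by the set `L` of the functions below it.
  let s : Finset ((Fin n → ℝ) → ℝ) → ((Fin n → ℝ) → ℝ) → SignType :=
    fun L ξ => if ξ ∈ L then 1 else -1
  have hs : ∀ L ξ, s L ξ ≠ 0 := fun L ξ => by
    simp only [s]; split_ifs <;> decide
  let active : Finset ((Fin n → ℝ) → ℝ) → Prop := fun L =>
    ∃ x ∈ C, ∃ t, (∀ ξ ∈ Ξ, SignType.sign (t - ξ x) = s L ξ) ∧ (specialize x f).eval t = 0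
  have hz := fun (L : Finset ((Fin n → ℝ) → ℝ)) (hL : active L) =>
    h.exists_root_function hf hlead hder hsign (s := s L) (fun ξ _ => hs L ξ) hL
  choose! z σ hcont hlt heq hzs hzf using hz
  have hz0 : ∀ L, active L → ∀ x ∈ C, (specialize x f).eval (z L x) = 0 := fun L hL x hx => by
    have := hzf L hL x hx (z L x) (hzs L hL x hx)
    rwa [sub_self, sign_zero, mul_zero, sign_eq_zero_iff] at this
  let 𝓛 := Ξ.powerset.filter active
  have hmem : ∀ ζ, ζ ∈ Ξ ∪ 𝓛.image z ↔ ζ ∈ Ξ ∨ ∃ L ⊆ Ξ, active L ∧ z L = ζ := fun ζ => by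
    simp [𝓛, and_assoc]
  refine ⟨Ξ ∪ 𝓛.image z, ?_, ?_, ?_, ?_, ?_, ?_⟩
  · intro ζ hζ
    rcases (hmem ζ).1 hζ with hζ | ⟨L, -, hL, rfl⟩
    · exact h.continuousOn ζ hζ
    · exact hcont L hL
  · intro ζ hζ
    rcases (hmem ζ).1 hζ with hζ | ⟨L, -, hL, rfl⟩
    · exact h.lt ζ hζ
    · exact hlt L hL
  · intro ζ hζ
    rcases (hmem ζ).1 hζ with hζ | ⟨L, -, hL, rfl⟩
    · exact h.eq ζ hζ
    · exact heq L hL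
  · intro ζ hζ η hη x hx y hy
    rcases (hmem ζ).1 hζ with hζ | ⟨L, hLΞ, hL, rfl⟩ <;>
      rcases (hmem η).1 hη with hη | ⟨M, hMΞ, hM, rfl⟩
    · exact h.sign_sub ζ hζ η hη x hx y hy
    · rw [← neg_sub (z M x), ← neg_sub (z M y), Left.sign_neg, Left.sign_neg,
        hzs M hM x hx ζ hζ, hzs M hM y hy ζ hζ]
    · rw [hzs L hL x hx η hη, hzs L hL y hy η hη]
    · -- Two different gaps are separated by a function of `Ξ`.
      have sep : ∀ L M, L ⊆ Ξ → active L → active M → ∀ ξ ∈ L, ξ ∉ M → ∀ x ∈ C,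
          z M x < z L x := by
        intro L M hLΞ hL hM ξ hξL hξM x hx
        have h1 := hzs L hL x hx ξ (hLΞ hξL)
        have h2 := hzs M hM x hx ξ (hLΞ hξL)
        simp only [s, if_pos hξL, if_neg hξM, sign_eq_one_iff, sign_eq_neg_one_iff] at h1 h2
        linarith
      by_cases hLM : L = M
      · subst hLM; simp
      · by_cases hsub : L ⊆ M
        · obtain ⟨ξ, hξM, hξL⟩ := Finset.not_subset.1 fun h => hLM (hsub.antisymm h)
          rw [sign_neg (sub_neg.2 (sep M L hMΞ hM hL ξ hξM hξL x hx)),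
            sign_neg (sub_neg.2 (sep M L hMΞ hM hL ξ hξM hξL y hy))]
        · obtain ⟨ξ, hξL, hξM⟩ := Finset.not_subset.1 hsub
          rw [sign_pos (sub_pos.2 (sep L M hLΞ hL hM ξ hξL hξM x hx)),
            sign_pos (sub_pos.2 (sep L M hLΞ hL hM ξ hξL hξM y hy))]
  · intro p hp x hx y hy t u htu
    have htu' : ∀ ξ ∈ Ξ, SignType.sign (t - ξ x) = SignType.sign (u - ξ y) := fun ξ hξ =>
      htu ξ (Finset.mem_union_left _ hξ)
    rcases Finset.mem_insert.1 hp with rfl | hp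
    swap
    · exact h.sign_eval p hp x hx y hy t u htu'
    by_cases hon : ∃ ξ ∈ Ξ, t = ξ x
    · obtain ⟨ξ, hξ, rfl⟩ := hon
      have h1 := htu' ξ hξ
      rw [sub_self, sign_zero, eq_comm, sign_eq_zero_iff, sub_eq_zero] at h1
      rw [h1]
      exact hsign ξ hξ x hx y hy
    push Not at hon
    let L := Ξ.filter fun ξ => ξ x < t
    have ht : ∀ ξ ∈ Ξ, SignType.sign (t - ξ x) = s L ξ := by
      intro ξ hξ
      rcases lt_or_gt_of_ne (hon ξ hξ) with h1 | h1
      · have : ξ ∉ L := fun h2 => h1.not_gt (Finset.mem_filter.1 h2).2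
        simp only [s, if_neg this]
        exact sign_neg (sub_neg.2 h1)
      · have : ξ ∈ L := Finset.mem_filter.2 ⟨hξ, h1⟩
        simp only [s, if_pos this]
        exact sign_pos (sub_pos.2 h1)
    have hu : ∀ ξ ∈ Ξ, SignType.sign (u - ξ y) = s L ξ := fun ξ hξ => by
      rw [← htu' ξ hξ, ht ξ hξ]
    by_cases hL : active L
    · rw [hzf L hL x hx t ht, hzf L hL y hy u hu, htu (z L) ((hmem _).2
        (Or.inr ⟨L, Finset.filter_subset _ _, hL, rfl⟩))]
    · have hgap : ∀ x' ∈ C, ∀ t', (∀ ξ ∈ Ξ, SignType.sign (t' - ξ x') = s L ξ) →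
          ∀ v ∈ gap Ξ (fun ξ => ξ x') t', (∀ ξ ∈ Ξ, SignType.sign (v - ξ x') = s L ξ) ∧
            (specialize x' p).eval v ≠ 0 := by
        intro x' hx' t' ht' v hv
        have hv' : ∀ ξ ∈ Ξ, SignType.sign (v - ξ x') = s L ξ := fun ξ hξ => by
          rw [← ht' ξ hξ]; exact hv ξ hξ
        exact ⟨hv', fun h0 => hL ⟨x', hx', v, hv', h0⟩⟩
      have hd : ∀ x' ∈ C, ∀ t', (∀ ξ ∈ Ξ, SignType.sign (t' - ξ x') = s L ξ) →
          SignType.sign ((specialize x' p).derivative.eval t') =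
            SignType.sign ((specialize x p).derivative.eval t) := by
        intro x' hx' t' ht'
        rw [derivative_specialize, derivative_specialize]
        exact h.sign_eval _ hder x' hx' x hx t' t fun ξ hξ => by rw [ht ξ hξ, ht' ξ hξ]
      have hσ : SignType.sign ((specialize x p).derivative.eval t) ≠ 0 := by
        intro h0
        rw [sign_eq_zero_iff, derivative_specialize] at h0
        have hne : specialize x p.derivative ≠ 0 := fun h0 => by
          rw [← derivative_specialize] at h0
          have := Polynomial.derivative_eq_zero.1 h0
          rw [natDegree_specialize (hlead x hx)] at this
          omega
        obtain ⟨ξ, hξ, e⟩ := h.exists_eq_of_root hder hx hne h0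
        exact hon ξ hξ e
      obtain ⟨v, hv, e⟩ := exists_sign_eq_mem_gap (s := Ξ) (a := fun ξ => ξ x)
        (b := fun ξ => ξ y) (p := specialize x p) (q := specialize y p) (t := t) (u := u) hσ
        (fun ξ hξ η hη => h.sign_sub ξ hξ η hη x hx y hy)
        (fun ξ hξ => hsign ξ hξ x hx y hy) htu' hon
        (fun v hv => hd x hx v (hgap x hx t ht v hv).1)
        (fun v hv => hd y hy v (hgap y hy u hu v hv).1)
        (by rwa [natDegree_specialize (hlead y hy)])
      rw [← e]
      exact sign_eval_eq_of_forall_ne_zero ordConnected_gap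
        (fun w hw => (hgap y hy u hu w hw).2) hv mem_gap_self
  · intro ζ hζ
    rcases (hmem ζ).1 hζ with hζ | ⟨L, -, hL, rfl⟩
    · obtain ⟨p, hp, h⟩ := h.root ζ hζ
      exact ⟨p, Finset.mem_insert_of_mem hp, h⟩
    · exact ⟨f, Finset.mem_insert_self _ _, hf, fun x hx => ⟨hlead x hx, hz0 L hL x hx⟩⟩

/-- A stable family is delineated over every set on which the signs of the leading coefficients are
constant. The members are added in the order of increasing degree. The sign of a member `f` at a
root function `ξ` of an earlier member `p` is that of the pseudo-remainder of `f` by `p`, up to a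
power of the leading coefficient of `p`, and this pseudo-remainder is an earlier member as well. If
the leading coefficient of `f` vanishes on the set, then `f` has the values of `f.eraseLead`. -/
theorem exists_isDelineation (h𝓕 : IsPseudoClosed 𝓕)
    (hC : ∀ f ∈ 𝓕, ∀ x ∈ C, ∀ y ∈ C, SignType.sign (MvPolynomial.aeval x f.leadingCoeff) =
      SignType.sign (MvPolynomial.aeval y f.leadingCoeff)) :
    ∃ Ξ, IsDelineation C Ξ 𝓕 := by
  classical
  suffices ∀ 𝓗 : Finset (Polynomial (MvPolynomial (Fin n) K)), 𝓗 ⊆ 𝓕 →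
      (∀ g ∈ 𝓕, ∀ f ∈ 𝓗, g.natDegree < f.natDegree → g ∈ 𝓗) → ∃ Ξ, IsDelineation C Ξ 𝓗 from
    this 𝓕 subset_rfl fun g hg _ _ _ => hg
  intro 𝓗
  refine Finset.induction_on_max_value Polynomial.natDegree 𝓗
    (fun _ _ => ⟨∅, by constructor <;> simp⟩) ?_
  · intro f 𝓗 hf𝓗 hmax ih hsub hlow
    have hlow' : ∀ g ∈ 𝓕, ∀ f' ∈ insert f 𝓗, g.natDegree < f'.natDegree → g ∈ 𝓗 := by
      intro g hg f' hf' hlt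
      refine (Finset.mem_insert.1 (hlow g hg f' hf' hlt)).resolve_left ?_
      rintro rfl
      rcases Finset.mem_insert.1 hf' with rfl | hf'
      · exact lt_irrefl _ hlt
      · exact absurd (hmax f' hf') (not_le.2 hlt)
    obtain ⟨Ξ, hΞ⟩ := ih ((Finset.subset_insert f 𝓗).trans hsub) fun g hg f' hf' =>
      hlow' g hg f' (Finset.mem_insert_of_mem hf')
    have hf𝓕 : f ∈ 𝓕 := hsub (Finset.mem_insert_self f 𝓗)
    rcases Nat.eq_zero_or_pos f.natDegree with hdeg | hdeg
    · refine ⟨Ξ, hΞ.insert_of_sign_eval fun x hx y hy t u _ => ?_⟩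
      have := hC f hf𝓕 x hx y hy
      rw [Polynomial.leadingCoeff, hdeg] at this
      rwa [Polynomial.eq_C_of_natDegree_eq_zero hdeg, specialize_C, specialize_C,
        Polynomial.eval_C, Polynomial.eval_C]
    obtain ⟨hder, herase, hrem⟩ := h𝓕 f hf𝓕 hdeg
    by_cases hlead : ∃ x ∈ C, MvPolynomial.aeval x f.leadingCoeff = 0
    · obtain ⟨x₀, hx₀, h0⟩ := hlead
      have herase' : f.eraseLead ∈ 𝓗 := by
        refine hlow' _ herase f (Finset.mem_insert_self f 𝓗) ?_
        have := f.eraseLead_natDegree_le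
        omega
      have key : ∀ x ∈ C, specialize x f = specialize x f.eraseLead := by
        intro x hx
        have h1 := hC f hf𝓕 x hx x₀ hx₀
        rw [h0, sign_zero, sign_eq_zero_iff] at h1
        conv_lhs => rw [← f.eraseLead_add_C_mul_X_pow]
        rw [map_add, map_mul, specialize_C, h1, Polynomial.C_0, zero_mul, add_zero]
      refine ⟨Ξ, hΞ.insert_of_sign_eval fun x hx y hy t u htu => ?_⟩
      rw [key x hx, key y hy]
      exact hΞ.sign_eval _ herase' x hx y hy t u htu
    · push Not at hlead
      refine hΞ.exists_insert hdeg hlead (hlow' _ hder f (Finset.mem_insert_self f 𝓗)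
        (Polynomial.natDegree_derivative_lt hdeg.ne')) fun ξ hξ x hx y hy => ?_
      obtain ⟨p, hp, hp0, hproot⟩ := hΞ.root ξ hξ
      have hp𝓕 : p ∈ 𝓕 := hsub (Finset.mem_insert_of_mem hp)
      obtain ⟨r, hr, hrdeg, k, q, e⟩ := (h𝓕 p hp𝓕 hp0).2.2 f hf𝓕 (hmax p hp)
      have hr𝓗 : r ∈ 𝓗 := hlow' r hr p (Finset.mem_insert_of_mem hp) hrdeg
      have key : ∀ x ∈ C, SignType.sign (MvPolynomial.aeval x p.leadingCoeff) ^ k *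
          SignType.sign ((specialize x f).eval (ξ x)) =
          SignType.sign ((specialize x r).eval (ξ x)) := by
        intro x hx
        have := congrArg (fun g => (specialize x g).eval (ξ x)) e
        simp only [map_mul, map_add, specialize_C, map_pow, Polynomial.eval_mul,
          Polynomial.eval_add, Polynomial.eval_pow, Polynomial.eval_C, (hproot x hx).2, zero_mul,
          zero_add] at this
        rw [← this, sign_mul, sign_pow]
      have h1 := hΞ.sign_eval r hr𝓗 x hx y hy (ξ x) (ξ y) fun η hη =>
        hΞ.sign_sub ξ hξ η hη x hx y hy
      rw [← key x hx, ← key y hy, hC p hp𝓕 x hx y hy] at h1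
      exact mul_left_cancel₀ (pow_ne_zero k fun h0 => (hproot y hy).1 (sign_eq_zero_iff.1 h0)) h1

end ExistsDelineation

/-! ### Decomposition into connected semialgebraic cells -/

section Cells

variable {K : Type} [Field K] [Algebra K ℝ] {n : ℕ} {C : Set (Fin n → ℝ)}
  {Ξ : Finset ((Fin n → ℝ) → ℝ)} {𝓕 : Finset (Polynomial (MvPolynomial (Fin n) K))}

/-- The graph of a function of a delineation over a connected set and the part between two
consecutive graphs are connected: a continuous section meets all the fibres, which are connected. -/
lemma IsDelineation.isPreconnected (h : IsDelineation C Ξ 𝓕) (hC : IsPreconnected C)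
    (s : ((Fin n → ℝ) → ℝ) → SignType) :
    IsPreconnected {z : Fin (n + 1) → ℝ | Fin.tail z ∈ C ∧
      ∀ ξ ∈ Ξ, SignType.sign (z 0 - ξ (Fin.tail z)) = s ξ} := by
  set E := {z : Fin (n + 1) → ℝ | Fin.tail z ∈ C ∧
    ∀ ξ ∈ Ξ, SignType.sign (z 0 - ξ (Fin.tail z)) = s ξ} with hE
  rcases E.eq_empty_or_nonempty with h0 | ⟨z₀, hz₀⟩
  · rw [h0]; exact isPreconnected_empty
  obtain ⟨τ, hτ, hτs⟩ := h.exists_section hz₀.1 (z₀ 0)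
  let γ : (Fin n → ℝ) → Fin (n + 1) → ℝ := fun x => Fin.cons (τ x) x
  have hγ : ContinuousOn γ C := fun x hx => Filter.Tendsto.finCons (hτ x hx) continuousWithinAt_id
  have hγE : ∀ x ∈ C, γ x ∈ E := fun x hx => by
    simp only [hE, Set.mem_ofPred_eq, γ, Fin.tail_cons, Fin.cons_zero]
    exact ⟨hx, fun ξ hξ => by rw [hτs x hx ξ hξ, hz₀.2 ξ hξ]⟩
  refine isPreconnected_of_forall (γ (Fin.tail z₀)) fun z hz => ?_
  let δ : ℝ → Fin (n + 1) → ℝ := fun t => Fin.cons t (Fin.tail z)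
  have hδ : Continuous δ := Continuous.finCons continuous_id continuous_const
  let G := gap Ξ (fun ξ => ξ (Fin.tail z)) (z 0)
  refine ⟨γ '' C ∪ δ '' G, ?_, Or.inl (Set.mem_image_of_mem _ hz₀.1),
    Or.inr ⟨z 0, mem_gap_self, Fin.cons_self_tail z⟩, ?_⟩
  · rintro _ (⟨x, hx, rfl⟩ | ⟨t, ht, rfl⟩)
    · exact hγE x hx
    · simp only [hE, Set.mem_ofPred_eq, δ, Fin.tail_cons, Fin.cons_zero]
      exact ⟨hz.1, fun ξ hξ => (ht ξ hξ).trans (hz.2 ξ hξ)⟩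
  · refine IsPreconnected.union (γ (Fin.tail z)) (Set.mem_image_of_mem _ hz.1)
      ⟨τ (Fin.tail z), fun ξ hξ => ?_, rfl⟩ (hC.image γ hγ)
      ((ordConnected_gap.isPreconnected).image δ hδ.continuousOn)
    rw [hτs _ hz.1 ξ hξ, hz₀.2 ξ hξ, hz.2 ξ hξ]

/-- `𝓒` is a finite cover of `ℝⁿ` by connected `K`-semialgebraic sets on which the polynomials
`P ∈ 𝓟` have constant signs. -/
structure IsCellCover (𝓟 : Finset (MvPolynomial (Fin n) K)) (𝓒 : Finset (Set (Fin n → ℝ))) :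
    Prop where
  cover : ∀ x, ∃ C ∈ 𝓒, x ∈ C
  isSemialgebraic : ∀ C ∈ 𝓒, IsSemialgebraic K C
  isPreconnected : ∀ C ∈ 𝓒, IsPreconnected C
  sign_eq : ∀ C ∈ 𝓒, ∀ P ∈ 𝓟, ∀ x ∈ C, ∀ y ∈ C,
    SignType.sign (MvPolynomial.aeval x P) = SignType.sign (MvPolynomial.aeval y P)

/-- A delineable family over the cells of a cover of `ℝⁿ` gives a cover of `ℝⁿ⁺¹`. -/
lemma IsCellCover.exists_succ {𝓟 : Finset (MvPolynomial (Fin n) K)}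
    {𝓒 : Finset (Set (Fin n → ℝ))} (h𝓒 : IsCellCover 𝓟 𝓒)
    (h : ∀ C ∈ 𝓒, ∃ Ξ, IsDelineation C Ξ 𝓕) (𝓠 : Finset (MvPolynomial (Fin (n + 1)) K))
    (h𝓠 : ∀ P ∈ 𝓠, MvPolynomial.finSuccEquiv K n P ∈ 𝓕) :
    ∃ 𝓔 : Finset (Set (Fin (n + 1) → ℝ)), IsCellCover 𝓠 𝓔 := by
  classical
  choose! Ξ hΞ using h
  let extend : ∀ C, (Ξ C → SignType) → ((Fin n → ℝ) → ℝ) → SignType := fun C s ξ =>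
    if hξ : ξ ∈ Ξ C then s ⟨ξ, hξ⟩ else 0
  let cell : ∀ C, (Ξ C → SignType) → Set (Fin (n + 1) → ℝ) := fun C s =>
    {z | Fin.tail z ∈ C ∧ ∀ ξ ∈ Ξ C, SignType.sign (z 0 - ξ (Fin.tail z)) = extend C s ξ}
  have hmem : ∀ E, E ∈ 𝓒.biUnion (fun C => Finset.univ.image (cell C)) ↔
      ∃ C ∈ 𝓒, ∃ s, cell C s = E := fun E => by simp
  refine ⟨𝓒.biUnion fun C => Finset.univ.image (cell C), ?_, ?_, ?_, ?_⟩
  · intro z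
    obtain ⟨C, hC, hz⟩ := h𝓒.cover (Fin.tail z)
    refine ⟨_, (hmem _).2 ⟨C, hC, fun ξ => SignType.sign (z 0 - ξ.1 (Fin.tail z)), rfl⟩, hz,
      fun ξ hξ => by simp [extend, hξ]⟩
  · intro E hE
    obtain ⟨C, hC, s, rfl⟩ := (hmem E).1 hE
    exact (IsSemialgebraicOver.forall_mem (Ξ C) fun ξ hξ => ((hΞ C hC).lt ξ hξ).sign_sub
      ((hΞ C hC).eq ξ hξ) (extend C s ξ)).isSemialgebraic (h𝓒.isSemialgebraic C hC)
  · intro E hE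
    obtain ⟨C, hC, s, rfl⟩ := (hmem E).1 hE
    exact (hΞ C hC).isPreconnected (h𝓒.isPreconnected C hC) _
  · intro E hE P hP z hz w hw
    obtain ⟨C, hC, s, rfl⟩ := (hmem E).1 hE
    rw [← Fin.cons_self_tail z, ← Fin.cons_self_tail w, aeval_cons, aeval_cons]
    exact (hΞ C hC).sign_eval _ (h𝓠 P hP) _ hz.1 _ hw.1 _ _ fun ξ hξ => by
      rw [hz.2 ξ hξ, hw.2 ξ hξ]

lemma IsCellCover.mono {𝓟 𝓠 : Finset (MvPolynomial (Fin n) K)} {𝓒 : Finset (Set (Fin n → ℝ))}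
    (h : IsCellCover 𝓠 𝓒) (h𝓟 : 𝓟 ⊆ 𝓠) : IsCellCover 𝓟 𝓒 :=
  ⟨h.cover, h.isSemialgebraic, h.isPreconnected, fun C hC P hP => h.sign_eq C hC P (h𝓟 hP)⟩

lemma IsCellCover.exists_isDelineation {𝓟 : Finset (MvPolynomial (Fin n) K)}
    {𝓒 : Finset (Set (Fin n → ℝ))} (h𝓒 : IsCellCover 𝓟 𝓒) (h𝓕 : IsPseudoClosed 𝓕)
    (h : ∀ f ∈ 𝓕, f.leadingCoeff ∈ 𝓟) : ∀ C ∈ 𝓒, ∃ Ξ, IsDelineation C Ξ 𝓕 :=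
  fun C hC => KZPeriod.exists_isDelineation h𝓕 fun f hf => h𝓒.sign_eq C hC _ (h f hf)

/-- Cylindrical decomposition: the cells of `ℝⁿ⁺¹` are the graphs of the root functions over the
cells of `ℝⁿ`, and the parts between them. -/
theorem exists_isCellCover : ∀ (n : ℕ) (𝓟 : Finset (MvPolynomial (Fin n) K)),
    ∃ 𝓒 : Finset (Set (Fin n → ℝ)), IsCellCover 𝓟 𝓒
  | 0, 𝓟 => ⟨{Set.univ}, fun x => ⟨Set.univ, by simp⟩,
      fun C hC => by rw [Finset.mem_singleton.1 hC]; exact isSemialgebraic_univ,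
      fun C _ => Set.subsingleton_of_subsingleton.isPreconnected,
      fun C _ P _ x _ y _ => by rw [Subsingleton.elim x y]⟩
  | n + 1, 𝓟 => by
    classical
    obtain ⟨𝓕, h𝓟𝓕, h𝓕⟩ := exists_isPseudoClosed_superset
      (𝓟.image (MvPolynomial.finSuccEquiv K n))
    obtain ⟨𝓒, h𝓒⟩ := exists_isCellCover n (𝓕.image Polynomial.leadingCoeff)
    exact h𝓒.exists_succ (h𝓒.exists_isDelineation h𝓕 fun f hf => Finset.mem_image_of_mem _ hf) 𝓟
      fun P hP => h𝓟𝓕 (Finset.mem_image_of_mem _ hP)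

/-- Cylindrical decomposition, together with delineations of given polynomials over the cells. -/
theorem exists_isCellCover_isDelineation (𝓟 : Finset (MvPolynomial (Fin n) K))
    (𝓕 : Finset (Polynomial (MvPolynomial (Fin n) K))) :
    ∃ (𝓒 : Finset (Set (Fin n → ℝ))) (𝓖 : Finset (Polynomial (MvPolynomial (Fin n) K))),
      IsCellCover 𝓟 𝓒 ∧ 𝓕 ⊆ 𝓖 ∧ ∀ C ∈ 𝓒, ∃ Ξ, IsDelineation C Ξ 𝓖 := by
  classical
  obtain ⟨𝓖, h𝓕𝓖, h𝓖⟩ := exists_isPseudoClosed_superset 𝓕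
  obtain ⟨𝓒, h𝓒⟩ := exists_isCellCover n (𝓟 ∪ 𝓖.image Polynomial.leadingCoeff)
  exact ⟨𝓒, 𝓖, h𝓒.mono Finset.subset_union_left, h𝓕𝓖, h𝓒.exists_isDelineation h𝓖
    fun f hf => Finset.mem_union_right _ (Finset.mem_image_of_mem _ hf)⟩

/-- A set that contains or avoids each cell of a cover is semialgebraic. -/
lemma IsCellCover.isSemialgebraic_of_forall {𝓟 : Finset (MvPolynomial (Fin n) K)}
    {𝓒 : Finset (Set (Fin n → ℝ))} (h𝓒 : IsCellCover 𝓟 𝓒) {S : Set (Fin n → ℝ)}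
    (hS : ∀ C ∈ 𝓒, ∀ x ∈ C, ∀ y ∈ C, x ∈ S → y ∈ S) : IsSemialgebraic K S := by
  classical
  have : S = ⋃ C ∈ 𝓒.filter (· ⊆ S), C := by
    ext x
    simp only [Finset.mem_filter, Set.mem_iUnion, exists_prop]
    constructor
    · intro hx
      obtain ⟨C, hC, hxC⟩ := h𝓒.cover x
      exact ⟨C, ⟨hC, fun y hy => hS C hC x hxC y hy hx⟩, hxC⟩
    · rintro ⟨C, ⟨_, hCS⟩, hxC⟩
      exact hCS hxC
  rw [this]
  exact isSemialgebraic_biUnion _ fun C hC => h𝓒.isSemialgebraic C (Finset.mem_filter.1 hC).1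

/-- A continuous function on a connected set whose values are roots of a delineated polynomial is
one of the functions of the delineation. -/
lemma IsDelineation.exists_eqOn (h : IsDelineation C Ξ 𝓕) (hC : IsPreconnected C)
    {p : Polynomial (MvPolynomial (Fin n) K)} (hp : p ∈ 𝓕) (hp0 : ∀ x ∈ C, specialize x p ≠ 0)
    {f : (Fin n → ℝ) → ℝ} (hf : ContinuousOn f C)
    (hroot : ∀ x ∈ C, (specialize x p).eval (f x) = 0) {x₀ : Fin n → ℝ} (hx₀ : x₀ ∈ C) :
    ∃ ξ ∈ Ξ, Set.EqOn f ξ C := by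
  obtain ⟨η, hη, e⟩ := h.exists_eq_of_root hp hx₀ (hp0 x₀ hx₀) (hroot x₀ hx₀)
  -- The position of `f x` with respect to `η x` is locally constant.
  have hcont : ContinuousOn (fun x => SignType.sign (f x - η x)) C := by
    intro x hx
    have hsgn : ∀ ξ ∈ Ξ, f x ≠ ξ x →
        ContinuousWithinAt (fun y => SignType.sign (f y - ξ y)) C x := fun ξ hξ hne =>
      (continuousAt_sign_of_ne_zero (sub_ne_zero.2 hne)).comp_continuousWithinAt
        (f := fun y => f y - ξ y) ((hf x hx).sub (h.continuousOn ξ hξ x hx))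
    by_cases hne : f x = η x
    · have hev : ∀ᶠ y in nhdsWithin x C, ∀ ξ ∈ Ξ, f x ≠ ξ x → f y ≠ ξ y := by
        rw [Filter.eventually_all_finset]
        intro ξ hξ
        by_cases h0 : f x = ξ x
        · exact Filter.Eventually.of_forall fun y hy => absurd h0 hy
        · filter_upwards [((hf x hx).sub (h.continuousOn ξ hξ x hx)).eventually_ne
            (sub_ne_zero.2 h0)] with y hy _
          exact sub_ne_zero.1 hy
      refine ContinuousWithinAt.congr_of_eventuallyEq
        (f := fun _ => SignType.sign (f x - η x)) continuousWithinAt_const ?_ rfl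
      filter_upwards [hev, self_mem_nhdsWithin] with y hy hyC
      obtain ⟨ξ, hξ, e'⟩ := h.exists_eq_of_root hp hyC (hp0 y hyC) (hroot y hyC)
      have h1 : f x = ξ x := by
        by_contra h1
        exact hy ξ hξ h1 e'
      rw [e', h1]
      exact h.sign_sub ξ hξ η hη y hyC x hx
    · exact hsgn η hη hne
  refine ⟨η, hη, fun x hx => ?_⟩
  have := hC.constant hcont hx hx₀
  simpa [← e, sub_eq_zero] using this

end Cells

/-! ### Elimination of algebraic coefficients -/

section AlgebraicCoefficients

variable {n : ℕ}

lemma isSemialgebraic_eval_algebraic {α : ℝ} (hα : IsIntegral ℚ α)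
    (R : Polynomial (MvPolynomial (Fin n) ℚ)) :
    IsSemialgebraic ℚ {x : Fin n → ℝ | 0 ≤ (specialize x R).eval α} := by
  classical
  let m : Polynomial (MvPolynomial (Fin n) ℚ) := (minpoly ℚ α).map (algebraMap _ _)
  have hm : ∀ x : Fin n → ℝ, specialize x m = (minpoly ℚ α).map (algebraMap ℚ ℝ) := fun x => by
    simp only [m, specialize_apply, Polynomial.map_map]
    exact congrArg (fun φ => Polynomial.map φ _) (Subsingleton.elim _ _)
  obtain ⟨𝓒, 𝓖, h𝓒, h𝓖, hΞ⟩ := exists_isCellCover_isDelineation (∅ : Finset (MvPolynomial _ ℚ))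
    {m, R}
  refine h𝓒.isSemialgebraic_of_forall fun C hC x hx y hy hxS => ?_
  obtain ⟨Ξ, hΞ⟩ := hΞ C hC
  -- Over a connected cell the constant function `α` is one of the root functions.
  obtain ⟨ξ, hξ, e⟩ := hΞ.exists_eqOn (h𝓒.isPreconnected C hC) (h𝓖 (Finset.mem_insert_self m {R}))
    (f := fun _ => α) (fun x _ => by
      rw [hm]; exact Polynomial.map_ne_zero (minpoly.ne_zero hα)) continuousOn_const
    (fun x _ => by rw [hm, Polynomial.eval_map_algebraMap, minpoly.aeval]) hx
  have := hΞ.sign_eval R (h𝓖 (by simp)) x hx y hy (ξ x) (ξ y) fun η hη =>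
    hΞ.sign_sub ξ hξ η hη x hx y hy
  rw [← e hx, ← e hy] at this
  rw [Set.mem_ofPred_eq, ← sign_nonneg_iff] at hxS ⊢
  rwa [← this]

/-- The coefficients of a polynomial over the real algebraic numbers are polynomials in a primitive
element of the number field they generate. -/
lemma exists_specialize_eval_eq (P : MvPolynomial (Fin n) RealAlg) :
    ∃ (α : ℝ) (R : Polynomial (MvPolynomial (Fin n) ℚ)), IsIntegral ℚ α ∧
      ∀ x : Fin n → ℝ, MvPolynomial.aeval x P = (specialize x R).eval α := by
  classical
  let S : Finset ℝ := P.support.image fun m => ((P.coeff m : RealAlg) : ℝ)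
  let E := IntermediateField.adjoin ℚ (S : Set ℝ)
  have : FiniteDimensional ℚ E := by
    refine IntermediateField.finiteDimensional_adjoin fun c hc => ?_
    obtain ⟨m, -, rfl⟩ := Finset.mem_image.1 (Finset.mem_coe.1 hc)
    exact (P.coeff m).2
  let pb := Field.powerBasisOfFiniteOfSeparable ℚ E
  have hg : ∀ m, ∃ g : Polynomial ℚ, m ∈ P.support →
      ((P.coeff m : RealAlg) : ℝ) = Polynomial.aeval (pb.gen : ℝ) g := by
    intro m
    by_cases hm : m ∈ P.support
    · have hE : ((P.coeff m : RealAlg) : ℝ) ∈ E :=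
        IntermediateField.subset_adjoin _ _ (Finset.mem_coe.2 (Finset.mem_image_of_mem _ hm))
      obtain ⟨g, hg⟩ := pb.exists_eq_aeval' ⟨_, hE⟩
      refine ⟨g, fun _ => ?_⟩
      have := congrArg (algebraMap E ℝ) hg
      rwa [← Polynomial.aeval_algebraMap_apply] at this
    · exact ⟨0, fun h => absurd h hm⟩
  choose g hg using hg
  refine ⟨pb.gen, ∑ m ∈ P.support, (g m).map (algebraMap ℚ (MvPolynomial (Fin n) ℚ)) *
    Polynomial.C (MvPolynomial.monomial m 1), ?_, fun x => ?_⟩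
  · exact (Algebra.IsIntegral.isIntegral pb.gen).map (E.val)
  · rw [map_sum, Polynomial.eval_finsetSum, MvPolynomial.aeval_def, MvPolynomial.eval₂_eq']
    refine Finset.sum_congr rfl fun m hm => ?_
    have h1 : specialize x ((g m).map (algebraMap ℚ (MvPolynomial (Fin n) ℚ))) =
        (g m).map (algebraMap ℚ ℝ) := by
      simp only [specialize_apply, Polynomial.map_map]
      exact congrArg (fun φ => Polynomial.map φ _) (Subsingleton.elim _ _)
    rw [map_mul, Polynomial.eval_mul, h1, Polynomial.eval_map_algebraMap, ← hg m hm, specialize_C,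
      Polynomial.eval_C, MvPolynomial.aeval_monomial, map_one, one_mul, Finsupp.prod_fintype _ _
      (fun _ => pow_zero _)]
    rfl

theorem IsSemialgebraic.of_realAlg {S : Set (Fin n → ℝ)} (h : IsSemialgebraic RealAlg S) :
    IsSemialgebraic ℚ S := by
  induction h with
  | nonneg P =>
    obtain ⟨α, R, hα, hR⟩ := exists_specialize_eval_eq P
    simp only [hR]
    exact isSemialgebraic_eval_algebraic hα R
  | union S T _ _ h1 h2 => exact h1.union _ _ h2
  | inter S T _ _ h1 h2 => exact h1.inter _ _ h2
  | compl S _ h => exact h.compl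

lemma IsDefinedByPolynomials.isSemialgebraic {K : Type} [Field K] [Algebra K ℝ]
    {S : Set (Fin n → ℝ)} (h : IsDefinedByPolynomials K S) : IsSemialgebraic K S := by
  obtain ⟨E, G, H, rfl⟩ := h
  have h1 := isSemialgebraic_biInter E fun P _ => isSemialgebraic_zero P
  have h2 := isSemialgebraic_biInter G fun P _ => IsSemialgebraic.nonneg P
  have h3 := isSemialgebraic_biInter H fun P _ => isSemialgebraic_pos P
  convert h1.inter _ _ (h2.inter _ _ h3) using 1
  ext x
  simp

end AlgebraicCoefficients

/-! ### Zero sets of polynomials are negligible -/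

section Null

open MeasureTheory

lemma specialize_leadingCoeff_ne_zero {K : Type} [Field K] [Algebra K ℝ] {n : ℕ}
    {p : Polynomial (MvPolynomial (Fin n) K)} {x : Fin n → ℝ}
    (h : MvPolynomial.aeval x p.leadingCoeff ≠ 0) : specialize x p ≠ 0 := by
  intro h0
  have := congrArg (fun q => q.coeff p.natDegree) h0
  exact h (by simpa [specialize_apply] using this)

theorem volume_aeval_eq_zero {K : Type} [Field K] [Algebra K ℝ] : ∀ {n : ℕ}
    {P : MvPolynomial (Fin n) K}, P ≠ 0 →
    volume {x : Fin n → ℝ | MvPolynomial.aeval x P = 0} = 0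
  | 0, P, hP => by
    obtain ⟨c, rfl⟩ := MvPolynomial.C_surjective (Fin 0) P
    have hc : algebraMap K ℝ c ≠ 0 := by
      simpa using fun h : c = 0 => hP (by rw [h, MvPolynomial.C_0])
    simp [hc]
  | n + 1, P, hP => by
    have hQ : MvPolynomial.finSuccEquiv K n P ≠ 0 := by simpa using hP
    have ih := volume_aeval_eq_zero (Polynomial.leadingCoeff_ne_zero.2 hQ)
    let e := MeasurableEquiv.piFinSuccAbove (fun _ : Fin (n + 1) => ℝ) 0
    have he : MeasurePreserving e := volume_preserving_piFinSuccAbove (fun _ => ℝ) 0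
    let V : Set (ℝ × (Fin n → ℝ)) :=
      {z | (specialize z.2 (MvPolynomial.finSuccEquiv K n P)).eval z.1 = 0}
    have hUV : {x : Fin (n + 1) → ℝ | MvPolynomial.aeval x P = 0} = e ⁻¹' V := by
      ext x
      rw [Set.mem_ofPred_eq, ← Fin.cons_self_tail x, aeval_cons]
      rfl
    have hV : MeasurableSet V := by
      rw [← e.measurableSet_preimage, ← hUV]
      exact (isSemialgebraic_zero P).measurableSet
    rw [hUV, he.measure_preimage hV.nullMeasurableSet, Measure.volume_eq_prod,
      Measure.prod_apply_symm hV]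
    refine (lintegral_congr_ae (g := fun _ => 0) ?_).trans lintegral_zero
    have : ∀ᵐ x : Fin n → ℝ, MvPolynomial.aeval x
        (MvPolynomial.finSuccEquiv K n P).leadingCoeff ≠ 0 := by
      rw [ae_iff]; simpa using ih
    filter_upwards [this] with x hx
    refine Set.Finite.measure_zero (((specialize x
      (MvPolynomial.finSuccEquiv K n P)).rootSet_finite ℝ).subset fun t ht => ?_) _
    rw [Polynomial.mem_rootSet]
    exact ⟨specialize_leadingCoeff_ne_zero hx, by simpa [V] using ht⟩

end Null

/-! ### The integral of a function as the integral of `2t` over a region below its graph -/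

section Region

open MeasureTheory

/-- The real numbers `t` such that `t * |t|` lies strictly between `0` and `c`. -/
def squareRegion (c : ℝ) : Set ℝ := {t | 0 < t ∧ t ^ 2 < c ∨ t < 0 ∧ t ^ 2 < -c}

lemma squareRegion_of_nonneg {c : ℝ} (hc : 0 ≤ c) : squareRegion c = Set.Ioo 0 (√c) := by
  ext t
  simp only [squareRegion, Set.mem_ofPred_eq, Set.mem_Ioo]
  constructor
  · rintro (⟨h, h'⟩ | ⟨h, h'⟩)
    · exact ⟨h, Real.lt_sqrt_of_sq_lt h'⟩
    · nlinarith
  · rintro ⟨h, h'⟩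
    exact Or.inl ⟨h, (Real.lt_sqrt h.le).1 h'⟩

lemma squareRegion_neg (c : ℝ) : squareRegion (-c) = -squareRegion c := by
  ext t
  simp only [squareRegion, Set.mem_ofPred_eq, Set.mem_neg, neg_sq, neg_neg, Left.neg_neg_iff,
    neg_pos]
  tauto

lemma squareRegion_of_nonpos {c : ℝ} (hc : c ≤ 0) : squareRegion c = Set.Ioo (-√(-c)) 0 := by
  rw [← neg_neg c, squareRegion_neg, squareRegion_of_nonneg (neg_nonneg.2 hc)]
  simp

lemma measurableSet_squareRegion (c : ℝ) : MeasurableSet (squareRegion c) := by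
  rcases le_total 0 c with hc | hc
  · rw [squareRegion_of_nonneg hc]; exact measurableSet_Ioo
  · rw [squareRegion_of_nonpos hc]; exact measurableSet_Ioo

lemma integrableOn_squareRegion (c : ℝ) : IntegrableOn (fun t : ℝ => 2 * t) (squareRegion c) := by
  have : ∀ a b : ℝ, IntegrableOn (fun t : ℝ => 2 * t) (Set.Ioo a b) := fun a b =>
    ((continuous_const.mul continuous_id).integrableOn_Icc).mono_set Set.Ioo_subset_Icc_self
  rcases le_total 0 c with hc | hc
  · rw [squareRegion_of_nonneg hc]; exact this _ _
  · rw [squareRegion_of_nonpos hc]; exact this _ _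

lemma integral_Ioo_two_mul {a b : ℝ} (hab : a ≤ b) :
    ∫ t in Set.Ioo a b, 2 * t = b ^ 2 - a ^ 2 := by
  rw [← integral_Ioc_eq_integral_Ioo, ← intervalIntegral.integral_of_le hab,
    intervalIntegral.integral_const_mul, integral_id]
  ring

lemma integral_squareRegion (c : ℝ) : ∫ t in squareRegion c, 2 * t = c := by
  rcases le_total 0 c with hc | hc
  · rw [squareRegion_of_nonneg hc, integral_Ioo_two_mul (Real.sqrt_nonneg c), Real.sq_sqrt hc]
    ring
  · rw [squareRegion_of_nonpos hc, integral_Ioo_two_mul (by simp [Real.sqrt_nonneg]), neg_sq,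
      Real.sq_sqrt (neg_nonneg.2 hc)]
    ring

lemma integral_norm_squareRegion (c : ℝ) : ∫ t in squareRegion c, ‖2 * t‖ = |c| := by
  rcases le_total 0 c with hc | hc
  · rw [abs_of_nonneg hc]
    refine Eq.trans ?_ (integral_squareRegion c)
    refine setIntegral_congr_fun (measurableSet_squareRegion c) fun t ht => ?_
    rw [squareRegion_of_nonneg hc] at ht
    exact Real.norm_of_nonneg (by linarith [ht.1])
  · rw [abs_of_nonpos hc]
    refine Eq.trans ?_ ((integral_neg _).trans (congrArg Neg.neg (integral_squareRegion c)))
    refine setIntegral_congr_fun (measurableSet_squareRegion c) fun t ht => ?_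
    rw [squareRegion_of_nonpos hc] at ht
    exact Real.norm_of_nonpos (by linarith [ht.2])

variable {n : ℕ}

/-- The points `(t, x)` of `ℝⁿ⁺¹` with `x ∈ S` and `t * |t|` strictly between `0` and `f x`. -/
def graphRegion (S : Set (Fin n → ℝ)) (f : (Fin n → ℝ) → ℝ) : Set (Fin (n + 1) → ℝ) :=
  {z | Fin.tail z ∈ S ∧ z 0 ∈ squareRegion (f (Fin.tail z))}

/-- Fubini for the region below a graph: integrating `2t` over the fibre `squareRegion (f x)` gives
`f x`, and integrating `|2t|` gives `|f x|`. -/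
lemma integrableOn_graphRegion {S : Set (Fin n → ℝ)} {f : (Fin n → ℝ) → ℝ}
    (hS : MeasurableSet S) (hR : MeasurableSet (graphRegion S f)) (hf : IntegrableOn f S) :
    IntegrableOn (fun z : Fin (n + 1) → ℝ => 2 * z 0) (graphRegion S f) ∧
      ∫ z in graphRegion S f, 2 * z 0 = ∫ x in S, f x := by
  classical
  let e := MeasurableEquiv.piFinSuccAbove (fun _ : Fin (n + 1) => ℝ) 0
  have he : MeasurePreserving e := volume_preserving_piFinSuccAbove (fun _ => ℝ) 0
  let V : Set (ℝ × (Fin n → ℝ)) := {z | z.2 ∈ S ∧ z.1 ∈ squareRegion (f z.2)}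
  have hUV : graphRegion S f = e ⁻¹' V := rfl
  have hV : MeasurableSet V := by rwa [← e.measurableSet_preimage, ← hUV]
  let g : ℝ × (Fin n → ℝ) → ℝ := V.indicator fun z => 2 * z.1
  have hgm : AEStronglyMeasurable g ((volume : Measure ℝ).prod volume) :=
    ((measurable_const.mul measurable_fst).indicator hV).aestronglyMeasurable
  have hslice : ∀ x t, g (t, x) =
      if x ∈ S then (squareRegion (f x)).indicator (fun t => 2 * t) t else 0 := by
    intro x t
    by_cases hx : x ∈ S <;> by_cases ht : t ∈ squareRegion (f x) <;> simp [g, V, hx, ht]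
  have hint : Integrable g ((volume : Measure ℝ).prod volume) := by
    rw [integrable_prod_iff' hgm]
    refine ⟨Filter.Eventually.of_forall fun x => ?_, ?_⟩
    · simp only [hslice]
      by_cases hx : x ∈ S
      · simp only [hx, if_true]
        exact (integrableOn_squareRegion (f x)).integrable_indicator (measurableSet_squareRegion _)
      · simp [hx]
    · refine (IntegrableOn.integrable_indicator (s := S) hf.abs hS).congr
        (Filter.Eventually.of_forall fun x => ?_)
      simp only [hslice]
      by_cases hx : x ∈ S
      · simp only [hx, if_true, Set.indicator_of_mem, norm_indicator_eq_indicator_norm]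
        rw [integral_indicator (measurableSet_squareRegion _), integral_norm_squareRegion]
      · simp [hx]
  have h1 : IntegrableOn (fun z : ℝ × (Fin n → ℝ) => 2 * z.1) V :=
    (integrable_indicator_iff hV).1 hint
  refine ⟨(he.integrableOn_comp_preimage e.measurableEmbedding).2 h1, ?_⟩
  calc ∫ z in graphRegion S f, 2 * z 0 = ∫ z in V, 2 * z.1 :=
        he.setIntegral_preimage_emb e.measurableEmbedding (fun z => 2 * z.1) V
    _ = ∫ z, g z := (integral_indicator hV).symm
    _ = ∫ x, ∫ t, g (t, x) := integral_prod_symm g hint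
    _ = ∫ x, S.indicator f x := by
        refine integral_congr_ae (Filter.Eventually.of_forall fun x => ?_)
        simp only [hslice]
        by_cases hx : x ∈ S
        · simp only [hx, if_true, Set.indicator_of_mem]
          rw [integral_indicator (measurableSet_squareRegion _), integral_squareRegion]
        · simp [hx]
    _ = ∫ x in S, f x := integral_indicator hS

end Region

/-! ### Algebraic functions and periods -/

section Periods

open MeasureTheory

variable {K : Type} [Field K] [Algebra K ℝ] {n : ℕ}

lemma IsSemialgebraicOver.comp {C : Set (Fin n → ℝ)} {r : (Fin n → ℝ) → ℝ → Prop}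
    (h : IsSemialgebraicOver K C r) (q : MvPolynomial (Fin (n + 1)) K) :
    IsSemialgebraicOver K C fun x t =>
      r x (MvPolynomial.aeval (Fin.cons t x : Fin (n + 1) → ℝ) q) := by
  obtain ⟨W, hW, h⟩ := h
  refine ⟨_, hW.preimage (Fin.cons q fun i => MvPolynomial.X i.succ), fun x hx t => ?_⟩
  refine Iff.trans ?_ (h x hx _)
  rw [Set.mem_ofPred_eq]
  congr! 1
  funext i
  refine Fin.cases ?_ (fun j => ?_) i <;> simp

lemma isSemialgebraicOver_squareRegion {C : Set (Fin n → ℝ)} {ξ : (Fin n → ℝ) → ℝ}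
    (hlt : IsSemialgebraicOver K C fun x t => t < ξ x)
    (heq : IsSemialgebraicOver K C fun x t => t = ξ x) :
    IsSemialgebraicOver K C fun x t => t ∈ squareRegion (ξ x) := by
  have hsgn := fun σ => IsSemialgebraicOver.sign_eval (K := K) (C := C) Polynomial.X σ
  refine (((hsgn 1).and (hlt.comp (MvPolynomial.X 0 ^ 2))).or ((hsgn (-1)).and
    ((hlt.or heq).comp (-MvPolynomial.X 0 ^ 2)).not)).congr fun x _ t => ?_
  simp only [squareRegion, Set.mem_ofPred_eq, specialize_X, Polynomial.eval_X, sign_eq_one_iff,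
    sign_eq_neg_one_iff, map_pow, map_neg, MvPolynomial.aeval_X, Fin.cons_zero,
    ← le_iff_lt_or_eq, not_le]
  rw [lt_neg]

/-- Up to a null set, the region below the graph of an algebraic function is semialgebraic: over a
connected cell, the function is one of finitely many semialgebraic root functions. -/
lemma IsAlgebraicFunctionOn.exists_isSemialgebraic_graphRegion {S : Set (Fin n → ℝ)}
    {f : (Fin n → ℝ) → ℝ} (hf : IsAlgebraicFunctionOn K S f) (hS : IsSemialgebraic K S) :
    ∃ S' : Set (Fin n → ℝ), IsSemialgebraic K S' ∧ S' ⊆ S ∧ S' =ᵐ[volume] S ∧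
      IsSemialgebraic K (graphRegion S' f) := by
  classical
  obtain ⟨D, F, hD, hF, hcont, hroot⟩ := hf
  let B := D * F.leadingCoeff
  have hB : B ≠ 0 := mul_ne_zero hD (Polynomial.leadingCoeff_ne_zero.2 hF)
  let S' := S ∩ {x | MvPolynomial.aeval x B = 0}ᶜ
  have hS' : IsSemialgebraic K S' := hS.inter _ _ (isSemialgebraic_zero B).compl
  have hB' : ∀ x ∈ S', MvPolynomial.aeval x D ≠ 0 ∧ MvPolynomial.aeval x F.leadingCoeff ≠ 0 :=
    fun x hx => by simpa [B] using hx.2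
  refine ⟨S', hS', Set.inter_subset_left, ?_, ?_⟩
  · refine Filter.EventuallyEq.trans (Filter.EventuallyEq.rfl.inter ?_)
      (Filter.EventuallyEq.of_eq (Set.inter_univ S))
    exact Filter.eventuallyEq_univ.2 (compl_mem_ae_iff.2 (volume_aeval_eq_zero hB))
  obtain ⟨𝓟, h𝓟⟩ := hS'.exists_sign_determined
  obtain ⟨𝓒, 𝓖, h𝓒, hF𝓖, hΞ⟩ := exists_isCellCover_isDelineation 𝓟 {F}
  have hU : graphRegion S' f = ⋃ C ∈ 𝓒.filter (· ⊆ S'), graphRegion C f := by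
    ext z
    simp only [graphRegion, Finset.mem_filter, Set.mem_iUnion, exists_prop, Set.mem_ofPred_eq]
    constructor
    · rintro ⟨hz, hz'⟩
      obtain ⟨C, hC, hzC⟩ := h𝓒.cover (Fin.tail z)
      exact ⟨C, ⟨hC, fun y hy => (h𝓟 _ y fun P hP => h𝓒.sign_eq C hC P hP _ hzC y hy).1 hz⟩,
        hzC, hz'⟩
    · rintro ⟨C, ⟨_, hCS⟩, hzC, hz'⟩
      exact ⟨hCS hzC, hz'⟩
  rw [hU]
  refine isSemialgebraic_biUnion _ fun C hC => ?_
  obtain ⟨hC, hCS⟩ := Finset.mem_filter.1 hC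
  rcases C.eq_empty_or_nonempty with rfl | ⟨x₀, hx₀⟩
  · simpa [graphRegion] using isSemialgebraic_empty
  obtain ⟨Ξ, hΞ⟩ := hΞ C hC
  obtain ⟨ξ, hξ, e⟩ := hΞ.exists_eqOn (h𝓒.isPreconnected C hC) (hF𝓖 (Finset.mem_singleton_self F))
    (fun x hx => specialize_leadingCoeff_ne_zero (hB' x (hCS hx)).2)
    (hcont.mono fun x hx => ⟨(hCS hx).1, (hB' x (hCS hx)).1⟩)
    (fun x hx => by
      rw [specialize_apply, Polynomial.eval_map]
      exact hroot x (hCS hx).1 (hB' x (hCS hx)).1) hx₀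
  exact ((isSemialgebraicOver_squareRegion (hΞ.lt ξ hξ) (hΞ.eq ξ hξ)).congr
    (r' := fun x t => t ∈ squareRegion (f x)) fun x hx t => by rw [e hx]).isSemialgebraic
    (h𝓒.isSemialgebraic C hC)

lemma algebraicIntegrals_realAlg_subset : algebraicIntegrals RealAlg ⊆ rationalIntegrals ℚ := by
  rintro a ⟨n, S, f, -, hS, hf, hint, rfl⟩
  obtain ⟨S', hS', hsub, hae, hreg⟩ := hf.exists_isSemialgebraic_graphRegion hS
  obtain ⟨h1, h2⟩ := integrableOn_graphRegion hS'.measurableSet hreg.measurableSet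
    (hint.mono_set hsub)
  refine ⟨n + 1, graphRegion S' f, fun z => 2 * z 0, Nat.le_add_left 1 n, hreg.of_realAlg,
    ⟨MvPolynomial.C 2 * MvPolynomial.X 0, 1, one_ne_zero, ?_⟩, h1, ?_⟩
  · funext z
    simp
  · rw [h2, setIntegral_congr_set hae]

lemma IsRationalFunction.isAlgebraicFunctionOn {f : (Fin n → ℝ) → ℝ} (hf : IsRationalFunction K f)
    (S : Set (Fin n → ℝ)) : IsAlgebraicFunctionOn K S f := by
  obtain ⟨P, Q, hQ, rfl⟩ := hf
  refine ⟨Q, Polynomial.C Q * Polynomial.X - Polynomial.C P, hQ, fun h => hQ ?_, ?_, ?_⟩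
  · simpa using congrArg (fun p => p.coeff 1) h
  · exact (continuous_aeval P).continuousOn.div (continuous_aeval Q).continuousOn fun x hx => hx.2
  · intro x _ hx
    rw [← Polynomial.eval_map, ← specialize_apply, map_sub, map_mul, specialize_C, specialize_C,
      specialize_X]
    simp only [Polynomial.eval_sub, Polynomial.eval_mul, Polynomial.eval_C, Polynomial.eval_X]
    rw [mul_div_cancel₀ _ hx, sub_self]

lemma rationalIntegrals_subset_algebraicIntegrals :
    rationalIntegrals K ⊆ algebraicIntegrals K := by
  rintro a ⟨n, S, f, hn, hS, hf, h⟩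
  exact ⟨n, S, f, hn, hS, hf.isAlgebraicFunctionOn S, h⟩

lemma IsSemialgebraic.baseChange (L : Type) [Field L] [Algebra L ℝ] [Algebra K L]
    [IsScalarTower K L ℝ] {S : Set (Fin n → ℝ)} (h : IsSemialgebraic K S) :
    IsSemialgebraic L S := by
  induction h with
  | nonneg P =>
    simpa only [MvPolynomial.aeval_map_algebraMap] using
      IsSemialgebraic.nonneg (MvPolynomial.map (algebraMap K L) P)
  | union S T _ _ h1 h2 => exact h1.union _ _ h2
  | inter S T _ _ h1 h2 => exact h1.inter _ _ h2
  | compl S _ h => exact h.compl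

lemma rationalIntegrals_subset_baseChange (L : Type) [Field L] [Algebra L ℝ] [Algebra K L]
    [IsScalarTower K L ℝ] : rationalIntegrals K ⊆ rationalIntegrals L := by
  rintro a ⟨n, S, f, hn, hS, ⟨P, Q, hQ, hf⟩, h⟩
  refine ⟨n, S, f, hn, hS.baseChange L, ⟨MvPolynomial.map (algebraMap K L) P,
    MvPolynomial.map (algebraMap K L) Q, fun h0 => hQ ?_, ?_⟩, h⟩
  · exact MvPolynomial.map_injective _ (algebraMap K L).injective (by rw [h0, map_zero])
  · simpa only [MvPolynomial.aeval_map_algebraMap] using hf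

end Periods

end KZPeriod

theorem mainTheorem6 :
    (∀ (n : ℕ) (S : Set (Fin n → ℝ)),
      KZPeriod.IsDefinedByPolynomials KZPeriod.RealAlg S → KZPeriod.IsSemialgebraic ℚ S) ∧
    (∀ (n : ℕ) (S : Set (Fin n → ℝ)),
      KZPeriod.IsSemialgebraic KZPeriod.RealAlg S → KZPeriod.IsSemialgebraic ℚ S) ∧
    KZPeriod.rationalPeriods KZPeriod.RealAlg = KZPeriod.periods ∧
    KZPeriod.algebraicPeriods KZPeriod.RealAlg = KZPeriod.periods := by
  have h1 := KZPeriod.rationalIntegrals_subset_baseChange (K := ℚ) KZPeriod.RealAlg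
  have h2 := KZPeriod.rationalIntegrals_subset_algebraicIntegrals (K := KZPeriod.RealAlg)
  have h3 := KZPeriod.algebraicIntegrals_realAlg_subset
  refine ⟨fun n S hS => hS.isSemialgebraic.of_realAlg, fun n S hS => hS.of_realAlg, ?_, ?_⟩
  · exact Set.Subset.antisymm (fun z hz => ⟨h3 (h2 hz.1), h3 (h2 hz.2)⟩)
      fun z hz => ⟨h1 hz.1, h1 hz.2⟩
  · exact Set.Subset.antisymm (fun z hz => ⟨h3 hz.1, h3 hz.2⟩)
      fun z hz => ⟨h2 (h1 hz.1), h2 (h1 hz.2)⟩
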